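/- **Setting.** A knapsack holds $m$ types of resources. In every period $s$ one request $(P_s,Q_s)=(P_s,Q^1_s,\dots,Q^m_s)$ arrives; the requests are i.i.d. with a law with finite support: with probability $\theta_i$ the request is of type $i$, i.e. offers the total reward $p_i\ge 0$ and needs the quantities $q_i=(q_i^1,\dots,q_i^m)\in\mathbb{N}^m$. A type with $p_i=0$ means "no request", and $q_i\ne 0$ whenever $p_i>0$. Requests are accepted completely or rejected. For the horizon $T\in\mathbb{N}$ the value function $V=V_T$ is given by $V(T+1,\cdot)=0$ and, for $t\le T$ and $d\in\mathbb{N}^m$, $$V(t,d)=V(t+1,d)\,\bigl[\theta_0+\Theta(d)\bigr]+\sum_{i:\;p_i>0,\;q_i\le d}\theta_i\max\{p_i+V(t+1,d-q_i),\,V(t+1,d)\},$$ where $\theta_0+\Theta(d)$ is the probability that there is no request or that it does not satisfy $Q\le d$. Let $X_{t,d}(T)$ be the (random) reward collected in the periods $t,\dots,T$, starting with inventory $d$, under the optimal policy: accept a request with $p_i>0$ and $q_i\le d$ if and only if $p_i+V(t+1,d-q_i)\ge V(t+1,d)$. Put $$\bar V^n(x)=\tfrac1n V_{nT}(\lfloor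 nx_0\rfloor,\lfloor nx_1\rfloor,\dots,\lfloor nx_m\rfloor),\qquad V^n(x)=\tfrac1n X_{\lfloor nx_0\rfloor,(\lfloor nx_1\rfloor,\dots,\lfloor nx_m\rfloor)}(nT),$$ $$G(z_1,\dots,z_m)=\mathbb{E}\Bigl[P-\sum_{k=1}^m Q^kz_k\Bigr]^+ ,$$ and let $D=(0,T)\times(0,\infty)^m$, $\bar D=[0,T]\times[0,\infty)^m$. **Theorem.** There are functions $u:\bar D\to\mathbb{R}$ and $h:[0,\infty)^m\to\mathbb{R}$ such that: 1. (Convergence.) For every $x\in\bar D$, $\bar V^n(x)\to u(x)$, and $V^n(x)\to u(x)$ almost surely, as $n\to\infty$. 2. (Regularity.) $u$ is Lipschitz on $\bar D$, and $C^2$ near almost every point of $D$. 3. (First order equation.) In $D$, $u$ satisfies $$\frac{\partial u}{\partial x_0}+G\Bigl(\frac{\partial u}{\partial x_1},\dots,\frac{\partial u}{\partial x_m}\Bigr)=0$$ in the viscosity sense (as an equation with terminal condition: $\varphi_{x_0}+G(\varphi_{x_1},\dots,\varphi_{x_m})$ is $\ge0$, respectively $\le0$, at every local maximum, respectively minimum,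 of $u-\varphi$, for every $C^1$ function $\varphi$), and in the classical sense at every point where $u$ is differentiable, hence almost everywhere. In particular, if every genuine request needs exactly one unit of each resource, then at these points $$\frac{\partial u}{\partial x_0}+\mathbb{E}\Bigl[P-\sum_{k=1}^m\frac{\partial u}{\partial x_k}\Bigr]^+=0 .$$ 4. (Boundary conditions.) $u(T,y)=h(y)$ for all $y\in[0,\infty)^m$, where $h(y)=\lim_{n}\tfrac1nV_{nT}(nT,\lfloor ny_1\rfloor,\dots,\lfloor ny_m\rfloor)$ is the scaled limit of the last-period value, which equals $0$; and $u(x_0,0,\dots,0)=0$ for $0\le x_0\le T$. 5. (Monge–Ampère equation.) $u$ satisfies $\det(D^2u)=0$ in $D$: classically at every point near which $u$ is $C^2$ (so almost everywhere), and on all of $D$ in the sense of Alexandrov: $u$ is concave in $D$, and the set of all supergradients of $u$ at points of $D$ has Lebesgue measure $0$ in $\mathbb{R}^{m+1}$. -/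

import Mathlib

open Filter Topology MeasureTheory ProbabilityTheory

noncomputable section

/-- The common law of the requests of an `m`-dimensional stochastic knapsack: finitely many request
types `i`, of probability `prob i`; a request of type `i` offers the reward `price i` and needs
`size i k` units of each resource `k`.  A type of price `0` stands for "no request".  A genuine
request needs at least one unit of something. -/
structure RequestLaw (ι : Type*) [Fintype ι] (m : ℕ) where
  prob : ι → ℝ
  price : ι → ℝ
  size : ι → Fin m → ℕ
  prob_nonneg : ∀ i, 0 ≤ prob i
  prob_sum : ∑ i, prob i = 1
  price_nonneg : ∀ i, 0 ≤ price i
  size_ne_zero : ∀ i, 0 < price i → size i ≠ 0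

namespace RequestLaw

variable {ι : Type*} [Fintype ι] {m : ℕ}

/-- There is a genuine request, and the inventory `d` can fulfil it. -/
def Feasible (L : RequestLaw ι m) (d : Fin m → ℕ) (i : ι) : Prop :=
  0 < L.price i ∧ L.size i ≤ d

open Classical in
/-- Dynamic programming recursion, by the number of periods to go. -/
def valueToGo (L : RequestLaw ι m) : ℕ → (Fin m → ℕ) → ℝ
  | 0, _ => 0
  | k + 1, d =>
      valueToGo L k d * (∑ i with ¬ L.Feasible d i, L.prob i) +
        ∑ i with L.Feasible d i,
          L.prob i * max (L.price i + valueToGo L k (d - L.size i)) (valueToGo L k d)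

/-- The value function `V(t, d)` for the horizon `T`: the periods `t, t + 1, …, T` are still to
come, and the available inventory is `d`. -/
def value (L : RequestLaw ι m) (T t : ℕ) (d : Fin m → ℕ) : ℝ :=
  L.valueToGo (T + 1 - t) d

open Classical in
/-- The reward collected over `k` periods from time `t` on, with inventory `d`, along the request
sequence `a`, under the optimal policy: a feasible request of type `i` is accepted if and only if
`price i + V(next, d - size i) ≥ V(next, d)`. -/
def revenueToGo (L : RequestLaw ι m) (a : ℕ → ι) : ℕ → ℕ → (Fin m → ℕ) → ℝ
  | 0, _, _ => 0
  | k + 1, t, d =>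
      if L.Feasible d (a t) ∧
          L.valueToGo k d ≤ L.price (a t) + L.valueToGo k (d - L.size (a t)) then
        L.price (a t) + revenueToGo L a k (t + 1) (d - L.size (a t))
      else revenueToGo L a k (t + 1) d

/-- `X_{t,d}(T)`: the reward collected in the periods `t, …, T` under the optimal policy. -/
def revenue (L : RequestLaw ι m) (a : ℕ → ι) (T t : ℕ) (d : Fin m → ℕ) : ℝ :=
  L.revenueToGo a (T + 1 - t) t d

/-- `G(z) = E[(P - ∑ₖ Qᵏ zₖ)⁺]`. -/
def lossFunction (L : RequestLaw ι m) (z : Fin m → ℝ) : ℝ :=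
  ∑ i, L.prob i * max (L.price i - ∑ k, (L.size i k : ℝ) * z k) 0

end RequestLaw

/-! Points of space-time are vectors `x = (x₀, x₁, …, xₘ)`: `x₀` is time, `xₖ` the inventory of
the `k`-th resource. -/

/-- The integer inventory `(⌊n x₁⌋, …, ⌊n xₘ⌋)`. -/
def scaledInventory {m : ℕ} (n : ℕ) (x : Fin (m + 1) → ℝ) : Fin m → ℕ :=
  fun k => ⌊(n : ℝ) * x k.succ⌋₊

/-- `[0, T] × [0, ∞)ᵐ`. -/
def closedDomain (T m : ℕ) : Set (Fin (m + 1) → ℝ) :=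
  {x | 0 ≤ x 0 ∧ x 0 ≤ T ∧ ∀ k : Fin m, 0 ≤ x k.succ}

/-- `(0, T) × (0, ∞)ᵐ`. -/
def openDomain (T m : ℕ) : Set (Fin (m + 1) → ℝ) :=
  {x | 0 < x 0 ∧ x 0 < T ∧ ∀ k : Fin m, 0 < x k.succ}

/-- The `i`-th partial derivative. -/
def partialDeriv {N : ℕ} (i : Fin N) (f : (Fin N → ℝ) → ℝ) (x : Fin N → ℝ) : ℝ :=
  fderiv ℝ f x (Pi.single i 1)

/-- The vector of first partial derivatives. -/
def grad {N : ℕ} (f : (Fin N → ℝ) → ℝ) (x : Fin N → ℝ) : Fin N → ℝ :=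
  fun i => partialDeriv i f x

/-- The matrix `D²f` of second partial derivatives. -/
def hessianMatrix {N : ℕ} (f : (Fin N → ℝ) → ℝ) (x : Fin N → ℝ) : Matrix (Fin N) (Fin N) ℝ :=
  Matrix.of fun i j => partialDeriv i (partialDeriv j f) x

/-- `u` is a viscosity solution in the open set `U` of the (backward in time, terminal value)
equation `F(∇u) = 0`, that is, of `-F(∇u) = 0` in the usual sign convention. -/
def IsViscositySolution {N : ℕ} (F : (Fin N → ℝ) → ℝ) (U : Set (Fin N → ℝ))
    (u : (Fin N → ℝ) → ℝ) : Prop :=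
  ContinuousOn u U ∧
    ∀ x ∈ U, ∀ φ : (Fin N → ℝ) → ℝ, ContDiff ℝ 1 φ →
      (IsLocalMax (fun y => u y - φ y) x → 0 ≤ F (grad φ x)) ∧
      (IsLocalMin (fun y => u y - φ y) x → F (grad φ x) ≤ 0)

/-- The supergradients at `x` of `u`, as a function on `U`. -/
def superdifferential {N : ℕ} (U : Set (Fin N → ℝ)) (u : (Fin N → ℝ) → ℝ) (x : Fin N → ℝ) :
    Set (Fin N → ℝ) :=
  {ζ | ∀ y ∈ U, u y ≤ u x + ∑ i, ζ i * (y i - x i)}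

/-- The concave function `u` solves `det D²u = 0` in `U` in the sense of Alexandrov: its
Monge–Ampère measure, which maps `E ⊆ U` to the volume of the set of all supergradients at
points of `E`, vanishes. -/
def IsAlexandrovHomogeneousMA {N : ℕ} (U : Set (Fin N → ℝ)) (u : (Fin N → ℝ) → ℝ) : Prop :=
  ConcaveOn ℝ U u ∧ volume (⋃ x ∈ U, superdifferential U u x) = 0

end

noncomputable section

namespace RequestLaw

variable {ι : Type*} [Fintype ι] {m : ℕ} (L : RequestLaw ι m)

/-! ### The fluid problem and its finitely many dual vertices -/

lemma lossFunction_nonneg (z : Fin m → ℝ) : 0 ≤ L.lossFunction z :=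
  Finset.sum_nonneg fun i _ => mul_nonneg (L.prob_nonneg i) (le_max_right _ _)

lemma continuous_lossFunction : Continuous L.lossFunction := by
  unfold lossFunction
  fun_prop

/-- The objective of the dual of the fluid problem, at the bid prices `z`, for the remaining time
`s` and the inventory `y`. -/
def dualCost (z : Fin m → ℝ) (s : ℝ) (y : Fin m → ℝ) : ℝ :=
  s * L.lossFunction z + ∑ k, y k * z k

lemma exists_forall_dualCost_le {s : ℝ} (hs : 0 ≤ s) {y : Fin m → ℝ} (hy : ∀ k, 0 < y k) :
    ∃ z, 0 ≤ z ∧ ∀ w, 0 ≤ w → L.dualCost z s y ≤ L.dualCost w s y := by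
  have hcont : Continuous fun z => L.dualCost z s y := by
    have := L.continuous_lossFunction
    unfold dualCost
    fun_prop
  have hmem : (0 : Fin m → ℝ) ∈ Set.Icc 0 fun k => L.dualCost 0 s y / y k := by
    refine ⟨le_rfl, fun k => div_nonneg ?_ (hy k).le⟩
    simpa [dualCost] using mul_nonneg hs (L.lossFunction_nonneg 0)
  obtain ⟨z, hz, hmin⟩ := isCompact_Icc.exists_isMinOn ⟨_, hmem⟩ hcont.continuousOn
  refine ⟨z, hz.1, fun w hw => ?_⟩
  by_cases hwb : w ∈ Set.Icc 0 fun k => L.dualCost 0 s y / y k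
  · exact hmin hwb
  · obtain ⟨k, hk⟩ : ∃ k, L.dualCost 0 s y / y k < w k := by
      by_contra! h
      exact hwb ⟨hw, h⟩
    rw [div_lt_iff₀ (hy k)] at hk
    have h1 : y k * w k ≤ ∑ k, y k * w k :=
      Finset.single_le_sum (f := fun k => y k * w k)
        (fun j _ => mul_nonneg (hy j).le (hw j)) (Finset.mem_univ k)
    have h2 := mul_nonneg hs (L.lossFunction_nonneg w)
    have h3 : L.dualCost z s y ≤ L.dualCost 0 s y := hmin hmem
    refine h3.trans ?_
    rw [show L.dualCost w s y = s * L.lossFunction w + ∑ k, y k * w k from rfl]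
    linarith

/-- The signs of the affine functions between whose zero sets the dual objective is affine. -/
def signPattern (z : Fin m → ℝ) : (ι → SignType) × (Fin m → SignType) :=
  (fun i => SignType.sign (L.price i - ∑ k, (L.size i k : ℝ) * z k),
    fun k => SignType.sign (z k))

lemma max_zero_eq_of_sign_eq {a b : ℝ} (h : SignType.sign a = SignType.sign b) :
    max a 0 = (if 0 < b then 1 else 0) * a := by
  split_ifs with hb
  · rw [sign_pos hb, sign_eq_one_iff] at h
    rw [max_eq_left h.le, one_mul]
  · have : a ≤ 0 := by
      by_contra! ha
      rw [sign_pos ha] at h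
      exact hb (sign_eq_one_iff.1 h.symm)
    rw [max_eq_right this, zero_mul]

lemma eventually_sign_add_mul_eq {a c : ℝ} (h : SignType.sign c = SignType.sign a) :
    ∀ᶠ t in 𝓝[>] (0 : ℝ), SignType.sign (a - t * (c - a)) = SignType.sign a := by
  have ht : Tendsto (fun t : ℝ => a - t * (c - a)) (𝓝[>] 0) (𝓝 a) := by
    have : Continuous fun t : ℝ => a - t * (c - a) := by fun_prop
    simpa using (this.tendsto 0).mono_left nhdsWithin_le_nhds
  rcases lt_trichotomy a 0 with ha | rfl | ha
  · filter_upwards [ht.eventually (gt_mem_nhds ha)] with t h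
    rw [sign_neg ha, sign_neg h]
  · rw [sign_zero, sign_eq_zero_iff] at h
    simp [h]
  · filter_upwards [ht.eventually (lt_mem_nhds ha)] with t h
    rw [sign_pos ha, sign_pos h]

lemma dualCost_eq_of_signPattern_eq {z w : Fin m → ℝ} (h : L.signPattern w = L.signPattern z)
    (s : ℝ) (y : Fin m → ℝ) :
    L.dualCost w s y = s * ∑ i, L.prob i *
      ((if 0 < L.price i - ∑ k, (L.size i k : ℝ) * z k then 1 else 0) *
        (L.price i - ∑ k, (L.size i k : ℝ) * w k)) + ∑ k, y k * w k := by
  unfold dualCost lossFunction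
  congr 2
  refine Finset.sum_congr rfl fun i _ => ?_
  rw [max_zero_eq_of_sign_eq (congrFun (congrArg Prod.fst h) i)]

/-- A minimal point of the dual objective can be replaced by any other one with the same signs. -/
lemma dualCost_le_of_signPattern_eq {z w : Fin m → ℝ} {s : ℝ} {y : Fin m → ℝ} (hz : 0 ≤ z)
    (hmin : ∀ v, 0 ≤ v → L.dualCost z s y ≤ L.dualCost v s y)
    (h : L.signPattern w = L.signPattern z) : L.dualCost w s y ≤ L.dualCost z s y := by
  have hev : ∀ᶠ t in 𝓝[>] (0 : ℝ), L.signPattern (fun k => z k - t * (w k - z k)) =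
      L.signPattern z := by
    have h1 : ∀ᶠ t in 𝓝[>] (0 : ℝ), ∀ i, SignType.sign ((L.price i - ∑ k, (L.size i k : ℝ) * z k) -
        t * ((L.price i - ∑ k, (L.size i k : ℝ) * w k) -
          (L.price i - ∑ k, (L.size i k : ℝ) * z k))) =
        SignType.sign (L.price i - ∑ k, (L.size i k : ℝ) * z k) :=
      eventually_all.2 fun i =>
        eventually_sign_add_mul_eq (congrFun (congrArg Prod.fst h) i)
    have h2 : ∀ᶠ t in 𝓝[>] (0 : ℝ), ∀ k, SignType.sign (z k - t * (w k - z k)) =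
        SignType.sign (z k) :=
      eventually_all.2 fun k =>
        eventually_sign_add_mul_eq (congrFun (congrArg Prod.snd h) k)
    filter_upwards [h1, h2] with t h1 h2
    refine Prod.ext (funext fun i => ?_) (funext h2)
    refine Eq.trans (congrArg SignType.sign ?_) (h1 i)
    simp only [mul_sub, Finset.sum_sub_distrib, mul_left_comm _ t, ← Finset.mul_sum]
    ring
  obtain ⟨t, ht, ht0⟩ := (hev.and self_mem_nhdsWithin).exists
  have ht0 : 0 < t := ht0
  have hv : (0 : Fin m → ℝ) ≤ fun k => z k - t * (w k - z k) := fun k => by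
    have h1 : SignType.sign (z k - t * (w k - z k)) = SignType.sign (z k) :=
      congrFun (congrArg Prod.snd ht) k
    by_contra! h2
    have h2 : z k - t * (w k - z k) < 0 := h2
    rw [sign_neg h2] at h1
    exact absurd (sign_eq_neg_one_iff.1 h1.symm) (not_lt.2 (hz k))
  have key := hmin _ hv
  rw [L.dualCost_eq_of_signPattern_eq ht, L.dualCost_eq_of_signPattern_eq (rfl : _ = L.signPattern z)]
    at key
  rw [L.dualCost_eq_of_signPattern_eq h, L.dualCost_eq_of_signPattern_eq (rfl : _ = L.signPattern z)]
  simp only [mul_sub, Finset.sum_sub_distrib, mul_left_comm _ t, ← Finset.mul_sum] at key ⊢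
  nlinarith [key]

lemma exists_dualVertices : ∃ Z : Finset (Fin m → ℝ), Z.Nonempty ∧ (∀ z ∈ Z, 0 ≤ z) ∧
    ∀ s y, 0 ≤ s → 0 ≤ y → ∃ z ∈ Z, ∀ w, 0 ≤ w → L.dualCost z s y ≤ L.dualCost w s y := by
  obtain ⟨S, hS, hbij⟩ := Set.exists_subset_bijOn {z : Fin m → ℝ | 0 ≤ z} L.signPattern
  have hfin : S.Finite := hbij.finite_iff_finite.2 (Set.toFinite _)
  have hpos : ∀ s (y : Fin m → ℝ), 0 ≤ s → (∀ k, 0 < y k) →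
      ∃ z ∈ S, ∀ w, 0 ≤ w → L.dualCost z s y ≤ L.dualCost w s y := fun s y hs hy => by
    obtain ⟨z, hz, hmin⟩ := L.exists_forall_dualCost_le hs hy
    obtain ⟨w, hw, hwz⟩ := hbij.surjOn ⟨z, hz, rfl⟩
    exact ⟨w, hw, fun v hv => (L.dualCost_le_of_signPattern_eq hz hmin hwz).trans (hmin v hv)⟩
  have hne : hfin.toFinset.Nonempty := by
    obtain ⟨z, hz, -⟩ := hpos 0 (fun _ => 1) le_rfl fun _ => one_pos
    exact ⟨z, hfin.mem_toFinset.2 hz⟩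
  refine ⟨hfin.toFinset, hne, fun z hz => hS (hfin.mem_toFinset.1 hz), fun s y hs hy => ?_⟩
  obtain ⟨z, hz, hmin⟩ := Finset.exists_min_image hfin.toFinset (fun z => L.dualCost z s y) hne
  refine ⟨z, hz, fun w hw => ?_⟩
  have hδ : ∀ δ : ℝ, 0 < δ → L.dualCost z s y ≤ L.dualCost w s y + δ * ∑ k, w k := fun δ hδ => by
    obtain ⟨v, hv, hvmin⟩ := hpos s (fun k => y k + δ) hs fun k => add_pos_of_nonneg_of_pos (hy k) hδ
    have h1 := hvmin w hw
    have h2 := hmin v (hfin.mem_toFinset.2 hv)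
    have h3 : 0 ≤ ∑ k, v k := Finset.sum_nonneg fun k _ => hS hv k
    simp only [dualCost, add_mul, Finset.sum_add_distrib, ← Finset.mul_sum] at h1 h2 ⊢
    nlinarith
  have hlim : Tendsto (fun δ : ℝ => L.dualCost w s y + δ * ∑ k, w k) (𝓝[>] 0)
      (𝓝 (L.dualCost w s y)) := by
    have : Continuous fun δ : ℝ => L.dualCost w s y + δ * ∑ k, w k := by fun_prop
    simpa using (this.tendsto 0).mono_left nhdsWithin_le_nhds
  exact ge_of_tendsto hlim (eventually_mem_nhdsWithin.mono hδ)

/-- A finite set of bid prices in which the dual of the fluid problem always has a solution. -/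
def dualVertices : Finset (Fin m → ℝ) := L.exists_dualVertices.choose

lemma dualVertices_nonempty : L.dualVertices.Nonempty := L.exists_dualVertices.choose_spec.1

lemma nonneg_of_mem_dualVertices {z : Fin m → ℝ} (hz : z ∈ L.dualVertices) : 0 ≤ z :=
  L.exists_dualVertices.choose_spec.2.1 z hz

/-- The value of the fluid problem with remaining time `s` and inventory `y`. -/
def fluidValue (s : ℝ) (y : Fin m → ℝ) : ℝ :=
  L.dualVertices.inf' L.dualVertices_nonempty fun z => L.dualCost z s y

lemma fluidValue_le_of_mem {z : Fin m → ℝ} (hz : z ∈ L.dualVertices) (s : ℝ) (y : Fin m → ℝ) :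
    L.fluidValue s y ≤ L.dualCost z s y :=
  Finset.inf'_le _ hz

lemma exists_fluidValue_eq (s : ℝ) (y : Fin m → ℝ) :
    ∃ z ∈ L.dualVertices, L.fluidValue s y = L.dualCost z s y :=
  Finset.exists_mem_eq_inf' _ _

lemma fluidValue_le_dualCost {s : ℝ} (hs : 0 ≤ s) {y w : Fin m → ℝ} (hy : 0 ≤ y) (hw : 0 ≤ w) :
    L.fluidValue s y ≤ L.dualCost w s y := by
  obtain ⟨z, hz, h⟩ := L.exists_dualVertices.choose_spec.2.2 s y hs hy
  exact (L.fluidValue_le_of_mem hz s y).trans (h w hw)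

/-- Weak duality. -/
lemma sum_mul_price_le_dualCost {s : ℝ} {r : ι → ℝ} (hs : 0 ≤ s) (hr : ∀ i, 0 ≤ r i)
    (hr1 : ∀ i, r i ≤ L.prob i) {y z : Fin m → ℝ} (hz : 0 ≤ z)
    (hy : ∀ k, s * ∑ i, r i * L.size i k ≤ y k) :
    s * ∑ i, r i * L.price i ≤ L.dualCost z s y := by
  have h1 : ∑ k, s * (∑ i, r i * L.size i k) * z k ≤ ∑ k, y k * z k :=
    Finset.sum_le_sum fun k _ => mul_le_mul_of_nonneg_right (hy k) (hz k)
  have h2 : ∑ i, r i * (L.price i - ∑ k, (L.size i k : ℝ) * z k) ≤ L.lossFunction z :=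
    Finset.sum_le_sum fun i _ =>
      (mul_le_mul_of_nonneg_left (le_max_left _ 0) (hr i)).trans
        (mul_le_mul_of_nonneg_right (hr1 i) (le_max_right _ _))
  have h3 : ∑ k, s * (∑ i, r i * L.size i k) * z k =
      s * ∑ i, r i * ∑ k, (L.size i k : ℝ) * z k := by
    simp only [Finset.mul_sum, Finset.sum_mul]
    rw [Finset.sum_comm]
    exact Finset.sum_congr rfl fun i _ => Finset.sum_congr rfl fun k _ => by ring
  have h4 := mul_le_mul_of_nonneg_left h2 hs
  simp only [mul_sub, Finset.sum_sub_distrib] at h4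
  unfold dualCost
  linarith

/-- The loss function at `z` is the reward, net of the bid prices, of accepting the requests that
are worth their bid price. -/
lemma exists_rates_lossFunction_eq (z : Fin m → ℝ) :
    ∃ r : ι → ℝ, (∀ i, 0 ≤ r i) ∧ (∀ i, r i ≤ L.prob i) ∧
      L.lossFunction z = ∑ i, r i * (L.price i - ∑ k, (L.size i k : ℝ) * z k) := by
  refine ⟨fun i => L.prob i * if 0 < L.price i - ∑ k, (L.size i k : ℝ) * z k then 1 else 0,
    fun i => ?_, fun i => ?_, ?_⟩
  · exact mul_nonneg (L.prob_nonneg i) (by split_ifs <;> norm_num)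
  · exact mul_le_of_le_one_right (L.prob_nonneg i) (by split_ifs <;> norm_num)
  · refine Finset.sum_congr rfl fun i _ => ?_
    rw [max_zero_eq_of_sign_eq rfl, mul_assoc]

/-- Strong duality. -/
lemma exists_rates_of_forall_le_dualCost {s α : ℝ} {y : Fin m → ℝ} (hy : 0 ≤ y)
    (hα : ∀ z, 0 ≤ z → α ≤ L.dualCost z s y) :
    ∃ r : ι → ℝ, (∀ i, 0 ≤ r i) ∧ (∀ i, r i ≤ L.prob i) ∧ (α ≤ s * ∑ i, r i * L.price i) ∧
      ∀ k, s * ∑ i, r i * L.size i k ≤ y k := by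
  classical
  let Φ : (ι → ℝ) →ₗ[ℝ] ℝ × (Fin m → ℝ) :=
    { toFun := fun r => (s * ∑ i, r i * L.price i, fun k => s * ∑ i, r i * L.size i k)
      map_add' := fun a b => by
        ext <;> simp [add_mul, mul_add, Finset.sum_add_distrib]
      map_smul' := fun c a => by
        ext <;> simp [Finset.mul_sum, mul_assoc, mul_left_comm] }
  have hΦ : Continuous Φ := Φ.continuous_of_finiteDimensional
  let K : Set (ℝ × (Fin m → ℝ)) := Φ '' Set.Icc 0 L.prob
  let B : Set (ℝ × (Fin m → ℝ)) := Set.Ici α ×ˢ Set.Iic y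
  by_contra! hno
  have hdisj : Disjoint K B := by
    rw [Set.disjoint_left]
    rintro _ ⟨r, hr, rfl⟩ ⟨h1, h2⟩
    obtain ⟨k, hk⟩ := hno r hr.1 hr.2 h1
    exact absurd (h2 k) (not_le.2 hk)
  obtain ⟨f, a, b, hfK, hab, hfB⟩ := geometric_hahn_banach_compact_closed
    ((convex_Icc 0 L.prob).linear_image Φ) (isCompact_Icc.image hΦ)
    ((convex_Ici α).prod (convex_Iic y)) (isClosed_Ici.prod isClosed_Iic) hdisj
  set c : ℝ := f (1, 0) with hc
  set z : Fin m → ℝ := fun k => - f (0, Pi.single k 1) with hz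
  have hf : ∀ t w, f (t, w) = t * c - ∑ k, w k * z k := fun t w => by
    have h1 : ((t, w) : ℝ × (Fin m → ℝ)) =
        t • ((1 : ℝ), (0 : Fin m → ℝ)) + ∑ k, w k • ((0 : ℝ), (Pi.single k 1 : Fin m → ℝ)) := by
      refine Prod.ext ?_ (funext fun j => ?_)
      · simp [Prod.fst_sum]
      · simp [Prod.snd_sum, Finset.sum_apply, Pi.single_apply]
    rw [h1, map_add, map_sum, map_smul]
    simp only [map_smul, hc, hz, smul_eq_mul, mul_neg, Finset.sum_neg_distrib, sub_neg_eq_add]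
  have hK : ∀ r, 0 ≤ r → r ≤ L.prob →
      s * ∑ i, r i * (c * L.price i - ∑ k, (L.size i k : ℝ) * z k) < a := fun r h0 h1 => by
    have := hfK _ ⟨r, ⟨h0, h1⟩, rfl⟩
    refine lt_of_eq_of_lt ?_ this
    rw [show Φ r = (s * ∑ i, r i * L.price i, fun k => s * ∑ i, r i * L.size i k) from rfl, hf]
    simp only [mul_sub, Finset.sum_sub_distrib, Finset.mul_sum, Finset.sum_mul]
    rw [Finset.sum_comm (s := (Finset.univ : Finset (Fin m)))]
    congr 1
    · exact Finset.sum_congr rfl fun i _ => by ring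
    · exact Finset.sum_congr rfl fun i _ => Finset.sum_congr rfl fun k _ => by ring
  have ha : 0 < a := by simpa using hK 0 le_rfl L.prob_nonneg
  have hB : ∀ (t : ℝ) (w : Fin m → ℝ), 0 ≤ t → 0 ≤ w → b < (α + t) * c - ∑ k, (y k - w k) * z k := fun t w ht hw => by
    rw [← hf]
    refine hfB _ ⟨?_, fun k => ?_⟩
    · simpa using ht
    · have := hw k
      simp only [Pi.zero_apply] at this
      simpa using this
  have hB0 := hB 0 0 le_rfl le_rfl
  simp only [add_zero, Pi.zero_apply, sub_zero] at hB0
  have hc0 : 0 ≤ c := by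
    by_contra! hneg
    have := hB ((b - (α * c - ∑ k, y k * z k)) / c) 0
      (div_nonneg_of_nonpos (by linarith) hneg.le) le_rfl
    simp only [Pi.zero_apply, sub_zero, add_mul, div_mul_cancel₀ _ hneg.ne] at this
    linarith
  have hz0 : 0 ≤ z := fun k => by
    by_contra! hneg
    have hneg : z k < 0 := hneg
    have := hB 0 (Pi.single k ((b - (α * c - ∑ k, y k * z k)) / z k)) le_rfl
      (Pi.single_nonneg.2 (div_nonneg_of_nonpos (by linarith) hneg.le))
    simp only [sub_mul, Finset.sum_sub_distrib, Pi.single_apply, ite_mul, zero_mul,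
      Finset.sum_ite_eq', Finset.mem_univ, if_true, add_zero, div_mul_cancel₀ _ hneg.ne] at this
    linarith
  have hyz : 0 ≤ ∑ k, y k * z k := Finset.sum_nonneg fun k _ => mul_nonneg (hy k) (hz0 k)
  rcases hc0.eq_or_lt with h0 | hpos
  · rw [← h0] at hB0
    linarith
  · obtain ⟨r, hr0, hr1, hr⟩ := L.exists_rates_lossFunction_eq fun k => z k / c
    have h1 := hK r hr0 hr1
    have h2 := hα (fun k => z k / c) fun k => div_nonneg (hz0 k) hc0
    have h3 : ∑ i, r i * (c * L.price i - ∑ k, (L.size i k : ℝ) * z k) =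
        c * L.lossFunction fun k => z k / c := by
      rw [hr, Finset.mul_sum]
      refine Finset.sum_congr rfl fun i _ => ?_
      rw [mul_left_comm c, mul_sub c, Finset.mul_sum (a := c)]
      congr 2
      exact Finset.sum_congr rfl fun k _ => by field_simp
    have h4 : ∑ k, y k * (z k / c) = (∑ k, y k * z k) / c := by
      rw [Finset.sum_div]
      exact Finset.sum_congr rfl fun k _ => by ring
    rw [dualCost, h4] at h2
    rw [h3] at h1
    have h5 := mul_le_mul_of_nonneg_right h2 hpos.le
    rw [add_mul, div_mul_cancel₀ _ hpos.ne'] at h5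
    nlinarith

/-! ### Bounds for the value function -/

open Classical in
lemma valueToGo_succ (k : ℕ) (d : Fin m → ℕ) :
    L.valueToGo (k + 1) d = ∑ i, L.prob i * (if L.Feasible d i then
      max (L.price i + L.valueToGo k (d - L.size i)) (L.valueToGo k d) else L.valueToGo k d) := by
  rw [valueToGo, Finset.mul_sum, Finset.sum_filter, Finset.sum_filter, ← Finset.sum_add_distrib]
  refine Finset.sum_congr rfl fun i _ => ?_
  by_cases h : L.Feasible d i
  · simp [h]
  · simp [h, mul_comm]

lemma sum_prob_mul_const (c : ℝ) : ∑ i, L.prob i * c = c := by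
  rw [← Finset.sum_mul, L.prob_sum, one_mul]

lemma valueToGo_le_succ (k : ℕ) (d : Fin m → ℕ) : L.valueToGo k d ≤ L.valueToGo (k + 1) d := by
  classical
  rw [valueToGo_succ, ← L.sum_prob_mul_const (L.valueToGo k d)]
  refine Finset.sum_le_sum fun i _ => mul_le_mul_of_nonneg_left ?_ (L.prob_nonneg i)
  rw [L.sum_prob_mul_const]
  split_ifs
  exacts [le_max_right _ _, le_rfl]

lemma valueToGo_nonneg (k : ℕ) (d : Fin m → ℕ) : 0 ≤ L.valueToGo k d := by
  induction k with
  | zero => exact le_of_eq rfl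
  | succ k ih => exact ih.trans (L.valueToGo_le_succ k d)

lemma valueToGo_mono (k : ℕ) {d d' : Fin m → ℕ} (h : d ≤ d') :
    L.valueToGo k d ≤ L.valueToGo k d' := by
  classical
  induction k generalizing d d' with
  | zero => exact le_of_eq rfl
  | succ k ih =>
    rw [valueToGo_succ, valueToGo_succ]
    refine Finset.sum_le_sum fun i _ => mul_le_mul_of_nonneg_left ?_ (L.prob_nonneg i)
    by_cases hd : L.Feasible d i
    · rw [if_pos hd, if_pos ⟨hd.1, hd.2.trans h⟩]
      exact max_le_max (by gcongr; exact ih (tsub_le_tsub_right h _)) (ih h)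
    · rw [if_neg hd]
      split_ifs
      exacts [(ih h).trans (le_max_right _ _), ih h]

lemma price_le_sum (i : ι) : L.price i ≤ ∑ i, L.price i :=
  Finset.single_le_sum (fun j _ => L.price_nonneg j) (Finset.mem_univ i)

lemma sum_price_nonneg : 0 ≤ ∑ i, L.price i := Finset.sum_nonneg fun i _ => L.price_nonneg i

lemma valueToGo_succ_le (k : ℕ) (d : Fin m → ℕ) :
    L.valueToGo (k + 1) d ≤ L.valueToGo k d + ∑ i, L.price i := by
  classical
  rw [valueToGo_succ, ← L.sum_prob_mul_const (L.valueToGo k d + ∑ i, L.price i)]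
  refine Finset.sum_le_sum fun i _ => mul_le_mul_of_nonneg_left ?_ (L.prob_nonneg i)
  have h1 := L.price_le_sum i
  have h2 := L.valueToGo_mono k (tsub_le_self : d - L.size i ≤ d)
  have h3 := L.sum_price_nonneg
  split_ifs
  · exact max_le (by linarith) (by linarith)
  · linarith

lemma valueToGo_zero_inventory (k : ℕ) : L.valueToGo k 0 = 0 := by
  classical
  induction k with
  | zero => rfl
  | succ k ih =>
    rw [valueToGo_succ]
    refine Finset.sum_eq_zero fun i _ => ?_
    rw [if_neg fun h => L.size_ne_zero i h.1 (le_antisymm h.2 fun _ => Nat.zero_le _), ih, mul_zero]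

lemma valueToGo_le_dualCost {z : Fin m → ℝ} (hz : 0 ≤ z) (k : ℕ) (d : Fin m → ℕ) :
    L.valueToGo k d ≤ L.dualCost z k (fun j => d j) := by
  classical
  have hdz : ∀ d : Fin m → ℕ, 0 ≤ ∑ j, (d j : ℝ) * z j := fun d =>
    Finset.sum_nonneg fun j _ => mul_nonneg (Nat.cast_nonneg _) (hz j)
  induction k generalizing d with
  | zero => simpa [valueToGo, dualCost] using hdz d
  | succ k ih =>
    have h1 : L.dualCost z (k + 1 : ℕ) (fun j => d j) = ∑ i, L.prob i *
        (L.dualCost z k (fun j => d j) + max (L.price i - ∑ j, (L.size i j : ℝ) * z j) 0) := by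
      simp only [mul_add, Finset.sum_add_distrib]
      rw [L.sum_prob_mul_const]
      simp only [dualCost, lossFunction]
      push_cast
      ring
    rw [valueToGo_succ, h1]
    refine Finset.sum_le_sum fun i _ => mul_le_mul_of_nonneg_left ?_ (L.prob_nonneg i)
    have h0 := le_max_right (L.price i - ∑ j, (L.size i j : ℝ) * z j) 0
    have hr := ih d
    split_ifs with hf
    · refine max_le ?_ (by linarith)
      have ha := ih (d - L.size i)
      have h2 : L.dualCost z k (fun j => ((d - L.size i) j : ℕ)) =
          L.dualCost z k (fun j => d j) - ∑ j, (L.size i j : ℝ) * z j := by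
        simp only [dualCost, Pi.sub_apply, Nat.cast_sub (hf.2 _), sub_mul, Finset.sum_sub_distrib]
        ring
      have h3 := le_max_left (L.price i - ∑ j, (L.size i j : ℝ) * z j) 0
      linarith
    · linarith

/-- The value of accepting requests of type `i` at the rate `r i` as long as the inventory permits:
up to an exponentially small loss, the reward rate is `∑ i, r i * price i`. -/
lemma le_valueToGo_of_rates {r : ι → ℝ} (hr0 : ∀ i, 0 ≤ r i) (hr1 : ∀ i, r i ≤ L.prob i)
    (hrp : ∀ i, r i ≠ 0 → 0 < L.price i) {J : Finset (Fin m)}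
    (hJ : ∀ i, r i ≠ 0 → ∀ j, j ∉ J → L.size i j = 0) {q : ℕ} (hq : ∀ i j, L.size i j ≤ q)
    {lam A : ℝ} (hlam : 0 ≤ lam) (hA : (∑ i, r i * L.price i) * Real.exp (lam * q) ≤ A)
    (N k : ℕ) (hk : k ≤ N) (d : Fin m → ℕ) :
    (∑ i, r i * L.price i) * k - A * N * ∑ j ∈ J, Real.exp (-(lam * d j) +
      k * ∑ i, r i * (Real.exp (lam * L.size i j) - 1)) ≤ L.valueToGo k d := by
  classical
  set ρ := ∑ i, r i * L.price i with hρ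
  set c : Fin m → ℝ := fun j => ∑ i, r i * (Real.exp (lam * L.size i j) - 1) with hc
  have hρ0 : 0 ≤ ρ := Finset.sum_nonneg fun i _ => mul_nonneg (hr0 i) (L.price_nonneg i)
  have hA0 : 0 ≤ A := (mul_nonneg hρ0 (Real.exp_pos _).le).trans hA
  have hc0 : ∀ j, 0 ≤ c j := fun j => Finset.sum_nonneg fun i _ => mul_nonneg (hr0 i)
    (sub_nonneg.2 (Real.one_le_exp (mul_nonneg hlam (Nat.cast_nonneg _))))
  induction k generalizing d with
  | zero =>
    simp only [Nat.cast_zero, mul_zero, zero_sub, valueToGo, zero_mul, add_zero]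
    exact neg_nonpos.2 (mul_nonneg (mul_nonneg hA0 (Nat.cast_nonneg _))
      (Finset.sum_nonneg fun j _ => (Real.exp_pos _).le))
  | succ k ih =>
    by_cases hf : ∀ i, r i ≠ 0 → L.Feasible d i
    · have h1 : ∀ i, r i * (L.price i + L.valueToGo k (d - L.size i)) +
          (L.prob i - r i) * L.valueToGo k d ≤ L.prob i * (if L.Feasible d i then
            max (L.price i + L.valueToGo k (d - L.size i)) (L.valueToGo k d)
              else L.valueToGo k d) := fun i => by
        by_cases hi : r i = 0
        · simp only [hi, zero_mul, zero_add, sub_zero]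
          refine mul_le_mul_of_nonneg_left ?_ (L.prob_nonneg i)
          split_ifs
          exacts [le_max_right _ _, le_rfl]
        · rw [if_pos (hf i hi)]
          have h2 := mul_le_mul_of_nonneg_left (le_max_left (L.price i +
            L.valueToGo k (d - L.size i)) (L.valueToGo k d)) (hr0 i)
          have h3 := mul_le_mul_of_nonneg_left (le_max_right (L.price i +
            L.valueToGo k (d - L.size i)) (L.valueToGo k d)) (sub_nonneg.2 (hr1 i))
          linarith
      rw [valueToGo_succ]
      refine le_trans ?_ (Finset.sum_le_sum fun i _ => h1 i)
      have hV := ih (by omega)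
      set E : Fin m → ℝ := fun j => Real.exp (-(lam * d j) + k * c j) with hE
      have h4 : ∀ i, r i * (L.price i + (ρ * k - A * N * ∑ j ∈ J,
            Real.exp (lam * L.size i j) * E j)) +
          (L.prob i - r i) * (ρ * k - A * N * ∑ j ∈ J, E j) ≤
          r i * (L.price i + L.valueToGo k (d - L.size i)) +
          (L.prob i - r i) * L.valueToGo k d := fun i => by
        refine add_le_add ?_ (mul_le_mul_of_nonneg_left (hV d) (sub_nonneg.2 (hr1 i)))
        by_cases hi : r i = 0
        · simp [hi]
        · refine mul_le_mul_of_nonneg_left (add_le_add le_rfl (le_trans (le_of_eq ?_)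
            (hV (d - L.size i)))) (hr0 i)
          congr 2
          refine Finset.sum_congr rfl fun j _ => ?_
          rw [hE, ← Real.exp_add, Pi.sub_apply, Nat.cast_sub ((hf i hi).2 j)]
          congr 1
          ring
      refine le_trans ?_ (Finset.sum_le_sum fun i _ => h4 i)
      have h5 : ∑ i, (r i * (L.price i + (ρ * k - A * N * ∑ j ∈ J,
            Real.exp (lam * L.size i j) * E j)) +
          (L.prob i - r i) * (ρ * k - A * N * ∑ j ∈ J, E j)) =
          ρ * (k + 1) - A * N * ∑ j ∈ J, (1 + c j) * E j := by
        have h6 : ∑ j ∈ J, (1 + c j) * E j = ∑ j ∈ J, E j +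
            ∑ i, r i * (∑ j ∈ J, Real.exp (lam * L.size i j) * E j - ∑ j ∈ J, E j) := by
          simp only [add_mul, one_mul, Finset.sum_add_distrib, hc, Finset.sum_mul,
            ← Finset.sum_sub_distrib, Finset.mul_sum]
          rw [Finset.sum_comm]
          congr 1
          exact Finset.sum_congr rfl fun i _ => Finset.sum_congr rfl fun k _ => by ring
        have h7 : ∀ i, (r i * (L.price i + (ρ * k - A * N * ∑ j ∈ J,
            Real.exp (lam * L.size i j) * E j)) +
          (L.prob i - r i) * (ρ * k - A * N * ∑ j ∈ J, E j)) =
          r i * L.price i + L.prob i * (ρ * k - A * N * ∑ j ∈ J, E j) - A * N *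
            (r i * (∑ j ∈ J, Real.exp (lam * L.size i j) * E j - ∑ j ∈ J, E j)) := fun i => by
          ring
        rw [Finset.sum_congr rfl fun i _ => h7 i, Finset.sum_sub_distrib, Finset.sum_add_distrib,
          L.sum_prob_mul_const, ← Finset.mul_sum, h6, ← hρ]
        ring
      rw [h5]
      push_cast
      refine sub_le_sub_left (mul_le_mul_of_nonneg_left (Finset.sum_le_sum fun j _ => ?_)
        (mul_nonneg hA0 (Nat.cast_nonneg _))) _
      rw [show -(lam * d j) + (k + 1) * c j = c j + (-(lam * d j) + k * c j) by ring, Real.exp_add]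
      refine mul_le_mul_of_nonneg_right ?_ (Real.exp_pos _).le
      linarith [Real.add_one_le_exp (c j)]
    · push Not at hf
      obtain ⟨i, hi, hfi⟩ := hf
      obtain ⟨j, hj⟩ : ∃ j, d j < L.size i j := by
        by_contra! h
        exact hfi ⟨hrp i hi, h⟩
      have hjJ : j ∈ J := by
        by_contra h
        have := hJ i hi j h
        omega
      refine le_trans ?_ (L.valueToGo_nonneg _ d)
      have h1 : Real.exp (-(lam * q)) ≤ ∑ j ∈ J, Real.exp (-(lam * d j) + (k + 1 : ℕ) * c j) := by
        refine le_trans ?_ (Finset.single_le_sum (f := fun j =>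
          Real.exp (-(lam * d j) + (k + 1 : ℕ) * c j)) (fun _ _ => (Real.exp_pos _).le) hjJ)
        refine Real.exp_le_exp.2 ?_
        have h2 : (d j : ℝ) ≤ q := by exact_mod_cast (hj.le.trans (hq i j))
        have h3 := mul_le_mul_of_nonneg_left h2 hlam
        have h4 : 0 ≤ ((k + 1 : ℕ) : ℝ) * c j := mul_nonneg (Nat.cast_nonneg _) (hc0 j)
        linarith
      have h5 : ρ ≤ A * Real.exp (-(lam * q)) := by
        have := mul_le_mul_of_nonneg_right hA (Real.exp_pos (-(lam * q))).le
        rwa [mul_assoc, ← Real.exp_add, add_neg_cancel, Real.exp_zero, mul_one] at this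
      have h6 : ((k + 1 : ℕ) : ℝ) ≤ N := by exact_mod_cast hk
      have h7 := mul_le_mul_of_nonneg_left h1 (mul_nonneg hA0 (Nat.cast_nonneg N))
      have h8 := mul_le_mul_of_nonneg_left h6 hρ0
      have h9 := mul_le_mul_of_nonneg_right h5 (Nat.cast_nonneg (α := ℝ) N)
      linarith

/-! ### Convergence of the scaled value function -/

lemma eventually_lt_zero_of_hasDerivAt {g : ℝ → ℝ} {g' : ℝ} (hg : HasDerivAt g g' 0)
    (h0 : g 0 = 0) (hg' : g' < 0) : ∀ᶠ t in 𝓝[>] (0 : ℝ), g t < 0 := by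
  filter_upwards [hg.tendsto_slope_zero_right.eventually (gt_mem_nhds hg'), self_mem_nhdsWithin]
    with t ht htpos
  rw [zero_add, h0, sub_zero, smul_eq_mul] at ht
  have htpos : 0 < t := htpos
  exact (pos_iff_neg_of_mul_neg ht).1 (inv_pos.2 htpos)

lemma eventually_lt_valueToGo_div_of_rates {s : ℝ} {y : Fin m → ℝ} {r : ι → ℝ}
    (hr0 : ∀ i, 0 ≤ r i) (hr1 : ∀ i, r i ≤ L.prob i) (hrp : ∀ i, r i ≠ 0 → 0 < L.price i)
    {J : Finset (Fin m)} (hJ : ∀ i, r i ≠ 0 → ∀ j, j ∉ J → L.size i j = 0)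
    (hJy : ∀ j ∈ J, s * ∑ i, r i * L.size i j < y j) {κ : ℕ → ℕ} {d : ℕ → Fin m → ℕ}
    (hκ : Tendsto (fun n => (κ n : ℝ) / n) atTop (𝓝 s))
    (hd : ∀ j, Tendsto (fun n => (d n j : ℝ) / n) atTop (𝓝 (y j)))
    {a : ℝ} (ha : a < s * ∑ i, r i * L.price i) :
    ∀ᶠ n : ℕ in atTop, a < L.valueToGo (κ n) (d n) / n := by
  obtain ⟨q, hq⟩ : ∃ q : ℕ, ∀ i j, L.size i j ≤ q :=
    ⟨∑ i, ∑ j, L.size i j, fun i j =>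
      (Finset.single_le_sum (f := fun j => L.size i j) (fun _ _ => Nat.zero_le _)
        (Finset.mem_univ j)).trans
      (Finset.single_le_sum (f := fun i => ∑ j, L.size i j) (fun _ _ => Nat.zero_le _)
        (Finset.mem_univ i))⟩
  have hlam : ∀ᶠ lam in 𝓝[>] (0 : ℝ), ∀ j ∈ J,
      s * (∑ i, r i * (Real.exp (lam * L.size i j) - 1)) - lam * y j < 0 := by
    refine (Finset.eventually_all J).2 fun j hj => ?_
    refine eventually_lt_zero_of_hasDerivAt (g' := s * (∑ i, r i * L.size i j) - y j) ?_ (by simp)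
      (sub_neg.2 (hJy j hj))
    refine HasDerivAt.sub (HasDerivAt.const_mul s (HasDerivAt.fun_sum fun i _ =>
      HasDerivAt.const_mul _ (HasDerivAt.sub_const 1 ?_))) ?_
    · simpa using ((hasDerivAt_id (0 : ℝ)).mul_const (L.size i j : ℝ)).exp
    · simpa using (hasDerivAt_id (0 : ℝ)).mul_const (y j)
  obtain ⟨lam, hlamJ, hlam0⟩ := (hlam.and self_mem_nhdsWithin).exists
  have hlam0 : 0 < lam := hlam0
  set ρ := ∑ i, r i * L.price i with hρ
  set c : Fin m → ℝ := fun j => ∑ i, r i * (Real.exp (lam * L.size i j) - 1) with hc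
  set A := ρ * Real.exp (lam * q) with hA
  have hexp : ∀ j ∈ J, Tendsto (fun n => Real.exp (-(lam * d n j) + κ n * c j)) atTop (𝓝 0) := by
    intro j hj
    refine Real.tendsto_exp_atBot.comp ?_
    have h1 : Tendsto (fun n => -(lam * ((d n j : ℝ) / n)) + (κ n : ℝ) / n * c j) atTop
        (𝓝 (-(lam * y j) + s * c j)) := ((hd j).const_mul lam).neg.add (hκ.mul_const _)
    have h2 := (tendsto_natCast_atTop_atTop (R := ℝ)).atTop_mul_neg
      (by linarith [hlamJ j hj]) h1
    refine h2.congr' ?_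
    filter_upwards [eventually_ne_atTop 0] with n hn
    have : (n : ℝ) ≠ 0 := Nat.cast_ne_zero.2 hn
    field_simp
  have hlim : Tendsto (fun n => ρ * ((κ n : ℝ) / n) - A * ((κ n : ℝ) / n) *
      ∑ j ∈ J, Real.exp (-(lam * d n j) + κ n * c j)) atTop (𝓝 (ρ * s - A * s * ∑ j ∈ J, 0)) :=
    (hκ.const_mul ρ).sub ((hκ.const_mul A).mul (tendsto_finsetSum J hexp))
  have ha' : a < ρ * s - A * s * ∑ j ∈ J, (0 : ℝ) := by
    simp only [Finset.sum_const_zero, mul_zero, sub_zero]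
    linarith
  filter_upwards [hlim.eventually (lt_mem_nhds ha')] with n hn
  refine hn.trans_le ?_
  have h1 := L.le_valueToGo_of_rates hr0 hr1 hrp hJ hq hlam0.le le_rfl (κ n) (κ n) le_rfl (d n)
  refine le_trans (le_of_eq ?_) (div_le_div_of_nonneg_right h1 (Nat.cast_nonneg n))
  simp only [← hρ, ← hA, hc]
  ring

lemma eventually_lt_valueToGo_div {s : ℝ} (hs : 0 ≤ s) {y : Fin m → ℝ} (hy : 0 ≤ y)
    {κ : ℕ → ℕ} {d : ℕ → Fin m → ℕ} (hκ : Tendsto (fun n => (κ n : ℝ) / n) atTop (𝓝 s))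
    (hd : ∀ j, Tendsto (fun n => (d n j : ℝ) / n) atTop (𝓝 (y j)))
    {a : ℝ} (ha : a < L.fluidValue s y) :
    ∀ᶠ n : ℕ in atTop, a < L.valueToGo (κ n) (d n) / n := by
  classical
  rcases lt_or_ge a 0 with ha0 | ha0
  · exact Eventually.of_forall fun n =>
      ha0.trans_le (div_nonneg (L.valueToGo_nonneg _ _) (Nat.cast_nonneg n))
  obtain ⟨r, hr0, hr1, hα, hry⟩ := L.exists_rates_of_forall_le_dualCost hy
    fun z hz => L.fluidValue_le_dualCost hs hy hz
  have hspos : 0 < s := hs.lt_of_ne fun h => by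
    rw [← h, zero_mul] at hα
    rw [← h] at ha
    linarith
  have hδ : ∀ᶠ δ in 𝓝[<] (1 : ℝ), a < δ * L.fluidValue s y := by
    have : Continuous fun δ : ℝ => δ * L.fluidValue s y := by fun_prop
    have h1 := (this.tendsto 1).mono_left (nhdsWithin_le_nhds (s := Set.Iio 1))
    exact h1.eventually (lt_mem_nhds (by simpa using ha))
  obtain ⟨δ, ⟨hδa, hδ1⟩, hδ0⟩ := ((hδ.and self_mem_nhdsWithin).and
    (mem_nhdsWithin_of_mem_nhds (lt_mem_nhds (zero_lt_one' ℝ)))).exists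
  have hδ1 : δ < 1 := hδ1
  have hδ0 : 0 < δ := hδ0
  set r' : ι → ℝ := fun i => if 0 < L.price i then δ * r i else 0 with hr'
  have hr'0 : ∀ i, 0 ≤ r' i := fun i => by
    simp only [hr']
    split_ifs
    exacts [mul_nonneg hδ0.le (hr0 i), le_rfl]
  have hr'r : ∀ i, r' i ≤ δ * r i := fun i => by
    simp only [hr']
    split_ifs
    exacts [le_rfl, mul_nonneg hδ0.le (hr0 i)]
  have hload : ∀ j, s * ∑ i, r' i * L.size i j ≤ δ * y j := fun j => by
    refine le_trans ?_ (mul_le_mul_of_nonneg_left (hry j) hδ0.le)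
    rw [mul_left_comm, Finset.mul_sum (a := δ)]
    refine mul_le_mul_of_nonneg_left (Finset.sum_le_sum fun i _ => ?_) hs
    rw [← mul_assoc]
    exact mul_le_mul_of_nonneg_right (hr'r i) (Nat.cast_nonneg _)
  refine L.eventually_lt_valueToGo_div_of_rates (s := s) (y := y) (r := r')
    (J := Finset.univ.filter fun j => 0 < y j) hr'0
    (fun i => (hr'r i).trans ((mul_le_of_le_one_left (hr0 i) hδ1.le).trans (hr1 i)))
    (fun i hi => ?_) (fun i hi j hj => ?_) (fun j hj => ?_) hκ hd ?_
  · by_contra h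
    exact hi (if_neg h)
  · have hyj : y j = 0 := le_antisymm (by simpa using hj) (hy j)
    have h1 := hload j
    rw [hyj, mul_zero] at h1
    have h2 : r' i * (L.size i j : ℝ) ≤ ∑ i, r' i * L.size i j :=
      Finset.single_le_sum (f := fun i => r' i * (L.size i j : ℝ))
        (fun i _ => mul_nonneg (hr'0 i) (Nat.cast_nonneg _)) (Finset.mem_univ i)
    have h3 : ∑ i, r' i * (L.size i j : ℝ) ≤ 0 := by
      by_contra! h
      exact absurd (mul_pos hspos h) (not_lt.2 h1)
    have h4 : r' i * (L.size i j : ℝ) = 0 :=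
      le_antisymm (h2.trans h3) (mul_nonneg (hr'0 i) (Nat.cast_nonneg _))
    exact_mod_cast (mul_eq_zero.1 h4).resolve_left hi
  · have hyj : 0 < y j := by simpa using hj
    exact (hload j).trans_lt (mul_lt_of_lt_one_left hyj hδ1)
  · refine hδa.trans_le ?_
    have h1 : ∑ i, r' i * L.price i = δ * ∑ i, r i * L.price i := by
      rw [Finset.mul_sum]
      refine Finset.sum_congr rfl fun i _ => ?_
      by_cases hi : 0 < L.price i
      · simp [hr', hi, mul_assoc]
      · have : L.price i = 0 := le_antisymm (not_lt.1 hi) (L.price_nonneg i)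
        simp [this]
    rw [h1, mul_left_comm]
    exact mul_le_mul_of_nonneg_left hα hδ0.le

theorem tendsto_valueToGo_div {s : ℝ} (hs : 0 ≤ s) {y : Fin m → ℝ} (hy : 0 ≤ y)
    {κ : ℕ → ℕ} {d : ℕ → Fin m → ℕ} (hκ : Tendsto (fun n => (κ n : ℝ) / n) atTop (𝓝 s))
    (hd : ∀ j, Tendsto (fun n => (d n j : ℝ) / n) atTop (𝓝 (y j))) :
    Tendsto (fun n : ℕ => L.valueToGo (κ n) (d n) / n) atTop (𝓝 (L.fluidValue s y)) := by
  refine tendsto_order.2 ⟨fun a ha => L.eventually_lt_valueToGo_div hs hy hκ hd ha, fun a ha => ?_⟩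
  obtain ⟨z, hz, h⟩ := L.exists_fluidValue_eq s y
  have hlim : Tendsto (fun n : ℕ => (κ n : ℝ) / n * L.lossFunction z +
      ∑ k, (d n k : ℝ) / n * z k) atTop (𝓝 (L.dualCost z s y)) :=
    (hκ.mul_const _).add (tendsto_finsetSum _ fun j _ => (hd j).mul_const _)
  rw [h] at ha
  filter_upwards [hlim.eventually (gt_mem_nhds ha)] with n hn
  refine lt_of_le_of_lt ?_ hn
  refine (div_le_div_of_nonneg_right (L.valueToGo_le_dualCost (L.nonneg_of_mem_dualVertices hz)
    (κ n) (d n)) (Nat.cast_nonneg n)).trans (le_of_eq ?_)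
  rw [dualCost, add_div, Finset.sum_div]
  congr 1
  · ring
  · exact Finset.sum_congr rfl fun k _ => by ring

end RequestLaw

lemma tendsto_scaledInventory_div {m : ℕ} {x : Fin (m + 1) → ℝ} (j : Fin m)
    (hx : 0 ≤ x j.succ) :
    Tendsto (fun n : ℕ => (scaledInventory n x j : ℝ) / n) atTop (𝓝 (x j.succ)) := by
  refine ((tendsto_nat_floor_mul_div_atTop hx).comp tendsto_natCast_atTop_atTop).congr fun n => ?_
  simp [scaledInventory, mul_comm]

lemma tendsto_periodsToGo_div {T : ℕ} {t : ℝ} (h0 : 0 ≤ t) (h1 : t ≤ T) :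
    Tendsto (fun n : ℕ => ((n * T + 1 - ⌊(n : ℝ) * t⌋₊ : ℕ) : ℝ) / n) atTop (𝓝 (T - t)) := by
  have h2 : Tendsto (fun n : ℕ => (T : ℝ) + (1 : ℝ) / n - (⌊t * (n : ℝ)⌋₊ : ℝ) / n) atTop
      (𝓝 (T + 0 - t)) :=
    (tendsto_const_nhds.add tendsto_one_div_atTop_nhds_zero_nat).sub
      ((tendsto_nat_floor_mul_div_atTop h0).comp tendsto_natCast_atTop_atTop)
  rw [add_zero] at h2
  refine h2.congr' ?_
  filter_upwards [eventually_ne_atTop 0] with n hn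
  have hn : (n : ℝ) ≠ 0 := Nat.cast_ne_zero.2 hn
  have h3 : ⌊(n : ℝ) * t⌋₊ ≤ n * T := by
    refine Nat.floor_le_of_le ?_
    push_cast
    exact mul_le_mul_of_nonneg_left h1 (Nat.cast_nonneg n)
  rw [Nat.cast_sub (h3.trans (Nat.le_succ _)), mul_comm t]
  push_cast
  field_simp

namespace RequestLaw

variable {ι : Type*} [Fintype ι] {m : ℕ} (L : RequestLaw ι m)

/-! ### Concentration of the optimal reward -/

lemma revenueToGo_congr {a b : ℕ → ι} (k t : ℕ) (d : Fin m → ℕ)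
    (h : ∀ s ∈ Finset.Ico t (t + k), a s = b s) :
    L.revenueToGo a k t d = L.revenueToGo b k t d := by
  induction k generalizing t d with
  | zero => rfl
  | succ k ih =>
    have h1 : ∀ d, L.revenueToGo a k (t + 1) d = L.revenueToGo b k (t + 1) d := fun d =>
      ih (t + 1) d fun s hs => h s (by rw [Finset.mem_Ico] at hs ⊢; omega)
    rw [revenueToGo, revenueToGo, h t (by rw [Finset.mem_Ico]; omega), h1, h1]

lemma nonempty_requestType (L : RequestLaw ι m) : Nonempty ι := by
  by_contra h
  rw [not_nonempty_iff] at h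
  simpa using L.prob_sum

lemma exists_revenueToGo_eq (k t : ℕ) (d : Fin m → ℕ) :
    ∃ F : (Finset.Ico t (t + k) → ι) → ℝ, ∀ a : ℕ → ι,
      L.revenueToGo a k t d = F fun s => a s := by
  have := L.nonempty_requestType
  refine ⟨fun b => L.revenueToGo (fun s => if h : s ∈ Finset.Ico t (t + k) then b ⟨s, h⟩ else
    Classical.arbitrary ι) k t d, fun a => L.revenueToGo_congr k t d fun s hs => ?_⟩
  rw [dif_pos hs]

open Classical in
/-- The value after a request of type `i`, including its reward. -/
def valueAfter (k : ℕ) (d : Fin m → ℕ) (i : ι) : ℝ :=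
  if L.Feasible d i then
    max (L.price i + L.valueToGo k (d - L.size i)) (L.valueToGo k d) else L.valueToGo k d

lemma abs_valueAfter_sub_le (k : ℕ) (d : Fin m → ℕ) (i : ι) :
    |L.valueAfter k d i - L.valueToGo (k + 1) d| ≤ ∑ i, L.price i := by
  have h1 := L.price_le_sum i
  have h2 := L.valueToGo_mono k (tsub_le_self : d - L.size i ≤ d)
  have h3 := L.sum_price_nonneg
  have h4 := L.valueToGo_le_succ k d
  have h5 := L.valueToGo_succ_le k d
  have h6 : L.valueToGo k d ≤ L.valueAfter k d i := by
    unfold valueAfter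
    split_ifs
    exacts [le_max_right _ _, le_rfl]
  have h7 : L.valueAfter k d i ≤ L.valueToGo k d + ∑ i, L.price i := by
    unfold valueAfter
    split_ifs
    · exact max_le (by linarith) (by linarith)
    · linarith
  rw [abs_le]
  constructor <;> linarith

/-- The reward and the inventory after the first period, in terms of the first request. -/
lemma exists_revenueToGo_succ (k t : ℕ) (d : Fin m → ℕ) :
    ∃ d' : ι → Fin m → ℕ, ∀ a : ℕ → ι, L.revenueToGo a (k + 1) t d - L.valueToGo (k + 1) d =
      (L.valueAfter k d (a t) - L.valueToGo (k + 1) d) +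
        (L.revenueToGo a k (t + 1) (d' (a t)) - L.valueToGo k (d' (a t))) := by
  classical
  refine ⟨fun i => if L.Feasible d i ∧
    L.valueToGo k d ≤ L.price i + L.valueToGo k (d - L.size i) then d - L.size i else d,
    fun a => ?_⟩
  rw [revenueToGo, valueAfter]
  by_cases h1 : L.Feasible d (a t)
  · by_cases h2 : L.valueToGo k d ≤ L.price (a t) + L.valueToGo k (d - L.size (a t))
    · simp only [h1, h2, and_self, if_true, max_eq_left]
      ring
    · simp only [h1, h2, and_false, if_false, if_true, max_eq_right (not_le.1 h2).le]
      ring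
  · simp only [h1, false_and, if_false]
    ring

variable {Ω : Type*} [MeasurableSpace Ω] {μ : Measure Ω} [IsProbabilityMeasure μ]
  [MeasurableSpace ι] [DiscreteMeasurableSpace ι] {ξ : ℕ → Ω → ι}

lemma integrable_exp_revenueToGo (hmeas : ∀ s, Measurable (ξ s)) (lam c : ℝ) (k t : ℕ)
    (d : Fin m → ℕ) :
    Integrable (fun ω => Real.exp (lam * (L.revenueToGo (fun s => ξ s ω) k t d - c))) μ := by
  obtain ⟨F, hF⟩ := L.exists_revenueToGo_eq k t d
  have h1 : Measurable fun ω => fun s : Finset.Ico t (t + k) => ξ s ω :=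
    measurable_pi_lambda _ fun s => hmeas s
  have : IsFiniteMeasure (μ.map fun ω => fun s : Finset.Ico t (t + k) => ξ s ω) := inferInstance
  have h2 : Integrable (fun b => Real.exp (lam * (F b - c)))
    (μ.map fun ω => fun s : Finset.Ico t (t + k) => ξ s ω) := Integrable.of_finite
  simp only [hF]
  exact h2.comp_measurable h1

lemma integral_exp_revenueToGo_le (hmeas : ∀ s, Measurable (ξ s)) (hindep : iIndepFun ξ μ)
    (hlaw : ∀ s i, μ.real (ξ s ⁻¹' {i}) = L.prob i) {lam : ℝ}
    (hlam : |lam| * ∑ i, L.price i ≤ 1) (k t : ℕ) (d : Fin m → ℕ) :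
    ∫ ω, Real.exp (lam * (L.revenueToGo (fun s => ξ s ω) k t d - L.valueToGo k d)) ∂μ ≤
      Real.exp (k * (lam * ∑ i, L.price i) ^ 2) := by
  classical
  induction k generalizing t d with
  | zero => simp [revenueToGo, valueToGo]
  | succ k ih =>
    obtain ⟨d', hd'⟩ := L.exists_revenueToGo_succ k t d
    set D : ι → ℝ := fun i => L.valueAfter k d i - L.valueToGo (k + 1) d with hD
    set C := ∑ i, L.price i with hC
    set Y : ι → Ω → ℝ := fun i ω =>
      Real.exp (lam * (L.revenueToGo (fun s => ξ s ω) k (t + 1) (d' i) - L.valueToGo k (d' i)))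
      with hY
    have hsplit : ∀ ω, Real.exp (lam * (L.revenueToGo (fun s => ξ s ω) (k + 1) t d -
        L.valueToGo (k + 1) d)) =
        ∑ i, Real.exp (lam * D i) * ((ξ t ⁻¹' {i}).indicator (fun _ => (1 : ℝ)) ω * Y i ω) := by
      intro ω
      rw [Finset.sum_eq_single (ξ t ω)]
      · rw [hd', mul_add, Real.exp_add]
        simp [hY, hD]
      · intro i _ hi
        rw [Set.indicator_of_notMem (by simpa using hi.symm)]
        ring
      · simp
    have hYint : ∀ i, Integrable (Y i) μ := fun i => L.integrable_exp_revenueToGo hmeas _ _ _ _ _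
    have hind : ∀ i, IndepFun ((ξ t ⁻¹' {i}).indicator fun _ => (1 : ℝ)) (Y i) μ := fun i => by
      obtain ⟨F, hF⟩ := L.exists_revenueToGo_eq k (t + 1) (d' i)
      have h1 := hindep.indepFun_finset {t} (Finset.Ico (t + 1) (t + 1 + k)) (by simp) hmeas
      have h2 := h1.comp (φ := fun b => if b ⟨t, by simp⟩ = i then (1 : ℝ) else 0)
        (ψ := fun b => Real.exp (lam * (F b - L.valueToGo k (d' i))))
        Measurable.of_discrete Measurable.of_discrete
      convert h2 using 1
      · funext ω
        simp [Set.indicator_apply]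
      · funext ω
        simp only [hY, hF, Function.comp]
    have hmi : ∀ i, Integrable ((ξ t ⁻¹' {i}).indicator fun _ => (1 : ℝ)) μ := fun i =>
      (integrable_const 1).indicator (hmeas t (measurableSet_singleton i))
    have hprod : ∀ i, ∫ ω, (ξ t ⁻¹' {i}).indicator (fun _ => (1 : ℝ)) ω * Y i ω ∂μ =
        L.prob i * ∫ ω, Y i ω ∂μ := fun i => by
      have h1 := (hind i).integral_mul_eq_mul_integral (hmi i).aestronglyMeasurable
        (hYint i).aestronglyMeasurable
      rw [integral_indicator_const _ (hmeas t (measurableSet_singleton i)), hlaw, smul_eq_mul,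
        mul_one] at h1
      exact h1
    simp only [hsplit]
    have hint : ∀ i, Integrable (fun ω => (ξ t ⁻¹' {i}).indicator (fun _ => (1 : ℝ)) ω * Y i ω) μ :=
      fun i => (hind i).integrable_mul (hmi i) (hYint i)
    rw [integral_finsetSum _ fun i _ => (hint i).const_mul _]
    simp only [integral_const_mul, hprod]
    have hstep : ∀ i, Real.exp (lam * D i) ≤ 1 + lam * D i + (lam * C) ^ 2 := fun i => by
      have h1 : |lam * D i| ≤ |lam| * C := by
        rw [abs_mul]
        exact mul_le_mul_of_nonneg_left (L.abs_valueAfter_sub_le k d i) (abs_nonneg _)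
      have h2 := (abs_le.1 (Real.abs_exp_sub_one_sub_id_le (h1.trans hlam))).2
      have h3 : (lam * D i) ^ 2 ≤ (lam * C) ^ 2 := by
        rw [sq_le_sq, abs_mul lam C, abs_of_nonneg L.sum_price_nonneg]
        exact h1
      linarith
    have hmean : ∑ i, L.prob i * D i = 0 := by
      simp only [hD, mul_sub, Finset.sum_sub_distrib, L.sum_prob_mul_const]
      rw [valueToGo_succ]
      exact sub_self _
    calc ∑ i, Real.exp (lam * D i) * (L.prob i * ∫ ω, Y i ω ∂μ)
        ≤ ∑ i, (1 + lam * D i + (lam * C) ^ 2) * (L.prob i * Real.exp (k * (lam * C) ^ 2)) := by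
          refine Finset.sum_le_sum fun i _ => ?_
          exact mul_le_mul (hstep i) (mul_le_mul_of_nonneg_left (ih _ _) (L.prob_nonneg i))
            (mul_nonneg (L.prob_nonneg i) (integral_nonneg fun ω => (Real.exp_pos _).le))
            ((Real.exp_pos _).le.trans (hstep i))
      _ = (1 + (lam * C) ^ 2) * Real.exp (k * (lam * C) ^ 2) := by
          have : ∀ i, (1 + lam * D i + (lam * C) ^ 2) * (L.prob i * Real.exp (k * (lam * C) ^ 2)) =
            L.prob i * ((1 + (lam * C) ^ 2) * Real.exp (k * (lam * C) ^ 2)) +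
              L.prob i * D i * (lam * Real.exp (k * (lam * C) ^ 2)) := fun i => by ring
          rw [Finset.sum_congr rfl fun i _ => this i, Finset.sum_add_distrib, L.sum_prob_mul_const,
            ← Finset.sum_mul, hmean]
          ring
      _ ≤ Real.exp ((lam * C) ^ 2) * Real.exp (k * (lam * C) ^ 2) := by
          refine mul_le_mul_of_nonneg_right ?_ (Real.exp_pos _).le
          linarith [Real.add_one_le_exp ((lam * C) ^ 2)]
      _ = Real.exp ((k + 1 : ℕ) * (lam * C) ^ 2) := by
          rw [← Real.exp_add]
          push_cast
          ring_nf

lemma measureReal_abs_revenueToGo_sub_le (hmeas : ∀ s, Measurable (ξ s)) (hindep : iIndepFun ξ μ)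
    (hlaw : ∀ s i, μ.real (ξ s ⁻¹' {i}) = L.prob i) {lam : ℝ} (hlam0 : 0 ≤ lam)
    (hlam : lam * ∑ i, L.price i ≤ 1) (k t : ℕ) (d : Fin m → ℕ) (ε : ℝ) :
    μ.real {ω | ε ≤ |L.revenueToGo (fun s => ξ s ω) k t d - L.valueToGo k d|} ≤
      2 * Real.exp (-lam * ε + k * (lam * ∑ i, L.price i) ^ 2) := by
  set Y : Ω → ℝ := fun ω => L.revenueToGo (fun s => ξ s ω) k t d - L.valueToGo k d with hY
  have h1 := measure_ge_le_exp_mul_mgf (μ := μ) (X := Y) ε hlam0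
    (L.integrable_exp_revenueToGo hmeas _ _ _ _ _)
  have h2 := measure_le_le_exp_mul_mgf (μ := μ) (X := Y) (-ε) (neg_nonpos.2 hlam0)
    (L.integrable_exp_revenueToGo hmeas _ _ _ _ _)
  have h3 : mgf Y μ lam ≤ _ := L.integral_exp_revenueToGo_le hmeas hindep hlaw
    (lam := lam) (by rwa [abs_of_nonneg hlam0]) k t d
  have h4 : mgf Y μ (-lam) ≤ _ := L.integral_exp_revenueToGo_le hmeas hindep hlaw
    (lam := -lam) (by rwa [abs_neg, abs_of_nonneg hlam0]) k t d
  have h5 : {ω | ε ≤ |Y ω|} ⊆ {ω | ε ≤ Y ω} ∪ {ω | Y ω ≤ -ε} := fun ω hω => by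
    rcases le_abs.1 (show ε ≤ |Y ω| from hω) with h | h
    · exact Or.inl h
    · exact Or.inr (show Y ω ≤ -ε by linarith)
  have h6 := (measureReal_mono h5 (measure_ne_top μ _)).trans (measureReal_union_le _ _)
  have h7 := mul_le_mul_of_nonneg_left h3 (Real.exp_pos (-lam * ε)).le
  have h8 := mul_le_mul_of_nonneg_left h4 (Real.exp_pos (-(-lam) * -ε)).le
  rw [← Real.exp_add, show -(-lam) * -ε = -lam * ε by ring,
    show (-lam * ∑ i, L.price i) ^ 2 = (lam * ∑ i, L.price i) ^ 2 by ring] at h8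
  rw [← Real.exp_add] at h7
  rw [show -(-lam) * -ε = -lam * ε by ring] at h2
  linarith

lemma ae_eventually_abs_revenueToGo_sub_lt (hmeas : ∀ s, Measurable (ξ s))
    (hindep : iIndepFun ξ μ) (hlaw : ∀ s i, μ.real (ξ s ⁻¹' {i}) = L.prob i) {T : ℕ}
    {κ : ℕ → ℕ} (hκ : ∀ n, κ n ≤ n * T + 1) (t : ℕ → ℕ) (d : ℕ → Fin m → ℕ) {ε : ℝ} (hε : 0 < ε) :
    ∀ᵐ ω ∂μ, ∀ᶠ n : ℕ in atTop,
      |L.revenueToGo (fun s => ξ s ω) (κ n) (t n) (d n) - L.valueToGo (κ n) (d n)| < n * ε := by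
  set C := ∑ i, L.price i with hC
  have hC0 : 0 ≤ C := L.sum_price_nonneg
  obtain ⟨lam, hlam0, hlam1, hlam2⟩ :
      ∃ lam : ℝ, 0 < lam ∧ lam * C ≤ 1 ∧ lam * (T * C ^ 2) ≤ ε / 2 := by
    refine ⟨min (1 / (C + 1)) (ε / 2 / (T * C ^ 2 + 1)), by positivity, ?_, ?_⟩
    · refine (mul_le_mul_of_nonneg_right (min_le_left _ _) hC0).trans ?_
      rw [div_mul_eq_mul_div, div_le_one (by positivity)]
      linarith
    · refine (mul_le_mul_of_nonneg_right (min_le_right _ _) (by positivity)).trans ?_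
      rw [div_mul_eq_mul_div, div_le_iff₀ (by positivity)]
      nlinarith
  have hbound : ∀ n : ℕ, μ {ω | n * ε ≤ |L.revenueToGo (fun s => ξ s ω) (κ n) (t n) (d n) -
      L.valueToGo (κ n) (d n)|} ≤
      ENNReal.ofReal (2 * Real.exp 1 * Real.exp (-(lam * (ε / 2))) ^ n) := fun n => by
    rw [← ENNReal.ofReal_toReal (measure_ne_top μ _)]
    refine ENNReal.ofReal_le_ofReal ((L.measureReal_abs_revenueToGo_sub_le hmeas hindep hlaw
      hlam0.le hlam1 (κ n) (t n) (d n) (n * ε)).trans ?_)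
    rw [mul_assoc, ← Real.exp_nat_mul, ← Real.exp_add]
    refine mul_le_mul_of_nonneg_left (Real.exp_le_exp.2 ?_) zero_le_two
    have h1 : (κ n : ℝ) ≤ n * T + 1 := by exact_mod_cast hκ n
    have h2 := mul_le_mul_of_nonneg_right h1 (sq_nonneg (lam * C))
    have h3 : (lam * C) ^ 2 ≤ 1 := pow_le_one₀ (mul_nonneg hlam0.le hC0) hlam1
    have h4 := mul_le_mul_of_nonneg_left hlam2 (mul_nonneg hlam0.le (Nat.cast_nonneg (α := ℝ) n))
    linarith
  have hsum : Summable fun n : ℕ => 2 * Real.exp 1 * Real.exp (-(lam * (ε / 2))) ^ n :=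
    (summable_geometric_of_lt_one (Real.exp_pos _).le
      (Real.exp_lt_one_iff.mpr (neg_neg_of_pos (by positivity)))).mul_left _
  have := ae_eventually_notMem (ne_top_of_le_ne_top hsum.tsum_ofReal_ne_top
    (ENNReal.tsum_le_tsum hbound))
  filter_upwards [this] with ω hω
  filter_upwards [hω] with n hn
  simpa using hn

theorem ae_tendsto_revenueToGo_div (hmeas : ∀ s, Measurable (ξ s)) (hindep : iIndepFun ξ μ)
    (hlaw : ∀ s i, μ.real (ξ s ⁻¹' {i}) = L.prob i) {T : ℕ} {κ : ℕ → ℕ}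
    (hκ : ∀ n, κ n ≤ n * T + 1) (t : ℕ → ℕ) (d : ℕ → Fin m → ℕ) {v : ℝ}
    (hv : Tendsto (fun n => L.valueToGo (κ n) (d n) / n) atTop (𝓝 v)) :
    ∀ᵐ ω ∂μ, Tendsto (fun n => L.revenueToGo (fun s => ξ s ω) (κ n) (t n) (d n) / n) atTop
      (𝓝 v) := by
  have hall : ∀ᵐ ω ∂μ, ∀ j : ℕ, ∀ᶠ n : ℕ in atTop,
      |L.revenueToGo (fun s => ξ s ω) (κ n) (t n) (d n) - L.valueToGo (κ n) (d n)| <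
        n * (1 / ((j : ℝ) + 1)) :=
    ae_all_iff.2 fun j => L.ae_eventually_abs_revenueToGo_sub_lt hmeas hindep hlaw hκ t d
      Nat.one_div_pos_of_nat
  filter_upwards [hall] with ω hω
  have h0 : Tendsto (fun n : ℕ => (L.revenueToGo (fun s => ξ s ω) (κ n) (t n) (d n) -
      L.valueToGo (κ n) (d n)) / n) atTop (𝓝 0) := by
    rw [Metric.tendsto_nhds]
    intro ε hε
    obtain ⟨j, hj⟩ := exists_nat_one_div_lt hε
    filter_upwards [hω j, eventually_gt_atTop 0] with n hn hn0
    have hn0 : (0 : ℝ) < n := Nat.cast_pos.2 hn0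
    rw [Real.dist_eq, sub_zero, abs_div, abs_of_pos hn0, div_lt_iff₀ hn0]
    refine hn.trans ?_
    rw [mul_comm]
    exact mul_lt_mul_of_pos_right hj hn0
  have h1 := h0.add hv
  rw [zero_add] at h1
  refine h1.congr fun n => ?_
  ring

end RequestLaw

/-! ### Calculus of supergradients -/

lemma grad_eq_of_eventually_le {N : ℕ} {φ : (Fin N → ℝ) → ℝ} {x ζ : Fin N → ℝ}
    (hφ : DifferentiableAt ℝ φ x)
    (h : ∀ᶠ y in 𝓝 x, φ y ≤ φ x + ∑ i, ζ i * (y i - x i)) : grad φ x = ζ := by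
  let ℓ : (Fin N → ℝ) →L[ℝ] ℝ := ∑ i, ζ i • ContinuousLinearMap.proj i
  have hℓ : ∀ y, ℓ y = ∑ i, ζ i * y i := fun y => by simp [ℓ]
  have hmax : IsLocalMax (fun y => φ y - ℓ y) x := by
    filter_upwards [h] with y hy
    simp only [hℓ]
    simp only [mul_sub, Finset.sum_sub_distrib] at hy
    linarith
  have h0 := hmax.fderiv_eq_zero
  rw [fderiv_fun_sub hφ ℓ.differentiableAt, ContinuousLinearMap.fderiv, sub_eq_zero] at h0
  funext i
  simp [grad, partialDeriv, h0, hℓ, Pi.single_apply]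

lemma grad_mem_superdifferential {N : ℕ} {U : Set (Fin N → ℝ)} {u φ : (Fin N → ℝ) → ℝ}
    {x : Fin N → ℝ} (hu : ConcaveOn ℝ U u) (hx : x ∈ U) (hφ : DifferentiableAt ℝ φ x)
    (h : IsLocalMax (fun y => u y - φ y) x) : grad φ x ∈ superdifferential U u x := by
  intro y hy
  have hsum : ∑ i, grad φ x i * (y i - x i) = fderiv ℝ φ x (y - x) := by
    conv_rhs => rw [pi_eq_sum_univ' (y - x)]
    simp only [map_sum, map_smul, smul_eq_mul, grad, partialDeriv, Pi.sub_apply]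
    refine Finset.sum_congr rfl fun i _ => ?_
    rw [mul_comm]
  rw [hsum]
  have hline : HasDerivAt (fun t : ℝ => φ (x + t • (y - x))) (fderiv ℝ φ x (y - x)) 0 := by
    have h1 : HasDerivAt (fun t : ℝ => x + t • (y - x)) (y - x) 0 := by
      simpa using ((hasDerivAt_id (0 : ℝ)).smul_const (y - x)).const_add x
    have h2 : HasFDerivAt φ (fderiv ℝ φ x) (x + (0 : ℝ) • (y - x)) := by
      simpa using hφ.hasFDerivAt
    exact h2.comp_hasDerivAt 0 h1
  have hslope := hline.tendsto_slope_zero_right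
  have hcont : Tendsto (fun t : ℝ => x + t • (y - x)) (𝓝[>] 0) (𝓝 x) := by
    have : Continuous fun t : ℝ => x + t • (y - x) := by fun_prop
    simpa using (this.tendsto 0).mono_left nhdsWithin_le_nhds
  have hev : ∀ᶠ t in 𝓝[>] (0 : ℝ),
      u y - u x ≤ t⁻¹ • (φ (x + (0 + t) • (y - x)) - φ (x + (0 : ℝ) • (y - x))) := by
    filter_upwards [hcont.eventually h, self_mem_nhdsWithin,
      mem_nhdsWithin_of_mem_nhds (gt_mem_nhds (zero_lt_one' ℝ))] with t ht ht0 ht1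
    have ht0 : 0 < t := ht0
    have ht1 : t < 1 := ht1
    have h1 := hu.2 hx hy (sub_nonneg.2 ht1.le) ht0.le (sub_add_cancel 1 t)
    rw [show (1 - t) • x + t • y = x + t • (y - x) by
      rw [sub_smul, one_smul, smul_sub]; abel] at h1
    simp only [smul_eq_mul] at h1
    rw [zero_add, zero_smul, add_zero, smul_eq_mul, inv_mul_eq_div, le_div_iff₀ ht0]
    nlinarith
  linarith [ge_of_tendsto hslope hev]

lemma isOpen_openDomain (T m : ℕ) : IsOpen (openDomain T m) := by
  simp only [openDomain, Set.ofPred_and, Set.ofPred_forall]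
  exact (isOpen_lt (by fun_prop) (by fun_prop)).inter ((isOpen_lt (by fun_prop) (by fun_prop)).inter
    (isOpen_iInter_of_finite fun k => isOpen_lt (by fun_prop) (by fun_prop)))

lemma convex_openDomain (T m : ℕ) : Convex ℝ (openDomain T m) := by
  intro x hx y hy a b ha hb hab
  have hpos : ∀ s t : ℝ, 0 < s → 0 < t → 0 < a * s + b * t := fun s t hs ht => by
    rcases ha.eq_or_lt with rfl | ha
    · rw [zero_add] at hab
      simpa [hab] using ht
    · exact add_pos_of_pos_of_nonneg (mul_pos ha hs) (mul_nonneg hb ht.le)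
  refine ⟨hpos _ _ hx.1 hy.1, ?_, fun k => hpos _ _ (hx.2.2 k) (hy.2.2 k)⟩
  have h1 := hpos _ _ (sub_pos.2 hx.2.1) (sub_pos.2 hy.2.1)
  simp only [Pi.add_apply, Pi.smul_apply, smul_eq_mul]
  have h2 : a * T + b * T = (T : ℝ) := by rw [← add_mul, hab, one_mul]
  linarith

namespace RequestLaw

variable {ι : Type*} [Fintype ι] {m : ℕ} (L : RequestLaw ι m)

/-! ### The limit of the scaled value functions -/

/-- The limit of the scaled value functions, as a function of time and inventory. -/
def limitValue (T : ℕ) (x : Fin (m + 1) → ℝ) : ℝ :=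
  L.fluidValue (T - x 0) fun k => x k.succ

/-- The gradient in time and inventory of the dual objective at the bid prices `z`. -/
def dualGradient (z : Fin m → ℝ) : Fin (m + 1) → ℝ := Fin.cons (-L.lossFunction z) z

@[simp] lemma dualGradient_zero (z : Fin m → ℝ) : L.dualGradient z 0 = -L.lossFunction z := rfl

@[simp] lemma dualGradient_succ (z : Fin m → ℝ) (k : Fin m) : L.dualGradient z k.succ = z k := rfl

lemma dualCost_eq_add_dualGradient (T : ℕ) (z : Fin m → ℝ) (x y : Fin (m + 1) → ℝ) :
    L.dualCost z (T - y 0) (fun k => y k.succ) = L.dualCost z (T - x 0) (fun k => x k.succ) +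
      ∑ i, L.dualGradient z i * (y i - x i) := by
  simp only [dualCost, Fin.sum_univ_succ, dualGradient_zero, dualGradient_succ, mul_sub,
    Finset.sum_sub_distrib, mul_comm (z _)]
  ring

lemma exists_dualGradient_supergradient (T : ℕ) (x : Fin (m + 1) → ℝ) :
    ∃ z ∈ L.dualVertices, ∀ y,
      L.limitValue T y ≤ L.limitValue T x + ∑ i, L.dualGradient z i * (y i - x i) := by
  obtain ⟨z, hz, h⟩ := L.exists_fluidValue_eq (T - x 0) fun k => x k.succ
  refine ⟨z, hz, fun y => ?_⟩
  rw [limitValue, limitValue, h, ← L.dualCost_eq_add_dualGradient]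
  exact L.fluidValue_le_of_mem hz _ _

lemma exists_lipschitzWith_limitValue (T : ℕ) : ∃ K, LipschitzWith K (L.limitValue T) := by
  refine ⟨∑ z ∈ L.dualVertices, ∑ i, ‖L.dualGradient z i‖₊,
    LipschitzWith.of_le_add_mul _ fun x y => ?_⟩
  obtain ⟨z, hz, h⟩ := L.exists_dualGradient_supergradient T y
  refine (h x).trans (add_le_add le_rfl ?_)
  have h1 : ∑ i, L.dualGradient z i * (x i - y i) ≤ (∑ i, ‖L.dualGradient z i‖) * dist x y := by
    rw [Finset.sum_mul]
    refine Finset.sum_le_sum fun i _ => (le_abs_self _).trans ?_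
    rw [abs_mul]
    exact mul_le_mul_of_nonneg_left (dist_le_pi_dist x y i) (abs_nonneg _)
  refine h1.trans (mul_le_mul_of_nonneg_right ?_ dist_nonneg)
  push_cast
  exact Finset.single_le_sum (f := fun z => ∑ i, ‖L.dualGradient z i‖)
    (fun _ _ => Finset.sum_nonneg fun _ _ => norm_nonneg _) hz

lemma concaveOn_limitValue (T : ℕ) : ConcaveOn ℝ (openDomain T m) (L.limitValue T) := by
  refine ⟨convex_openDomain T m, fun x _ y _ a b ha hb hab => ?_⟩
  obtain ⟨z, -, h⟩ := L.exists_dualGradient_supergradient T (a • x + b • y)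
  have h1 := mul_le_mul_of_nonneg_left (h x) ha
  have h2 := mul_le_mul_of_nonneg_left (h y) hb
  have h3 : a * ∑ i, L.dualGradient z i * (x i - (a • x + b • y) i) +
      b * ∑ i, L.dualGradient z i * (y i - (a • x + b • y) i) = 0 := by
    rw [Finset.mul_sum, Finset.mul_sum, ← Finset.sum_add_distrib]
    refine Finset.sum_eq_zero fun i _ => ?_
    simp only [Pi.add_apply, Pi.smul_apply, smul_eq_mul]
    obtain rfl : a = 1 - b := by linarith
    ring
  simp only [smul_eq_mul]
  have h4 : a * L.limitValue T (a • x + b • y) + b * L.limitValue T (a • x + b • y) =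
    L.limitValue T (a • x + b • y) := by rw [← add_mul, hab, one_mul]
  linarith

lemma exists_grad_eq_dualGradient {T : ℕ} {x : Fin (m + 1) → ℝ} {φ : (Fin (m + 1) → ℝ) → ℝ}
    (hφ : DifferentiableAt ℝ φ x)
    (h : ∀ᶠ y in 𝓝 x, φ y - φ x ≤ L.limitValue T y - L.limitValue T x) :
    ∃ z ∈ L.dualVertices, grad φ x = L.dualGradient z := by
  obtain ⟨z, hz, hsup⟩ := L.exists_dualGradient_supergradient T x
  refine ⟨z, hz, grad_eq_of_eventually_le hφ ?_⟩
  filter_upwards [h] with y hy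
  linarith [hsup y]

lemma exists_grad_limitValue_eq {T : ℕ} {x : Fin (m + 1) → ℝ}
    (h : DifferentiableAt ℝ (L.limitValue T) x) :
    ∃ z ∈ L.dualVertices, grad (L.limitValue T) x = L.dualGradient z :=
  L.exists_grad_eq_dualGradient h (Eventually.of_forall fun _ => le_rfl)

lemma fluidValue_mul {τ : ℝ} (hτ : 0 ≤ τ) (s : ℝ) (y : Fin m → ℝ) :
    L.fluidValue (τ * s) (fun k => τ * y k) = τ * L.fluidValue s y := by
  have h : ∀ z, L.dualCost z (τ * s) (fun k => τ * y k) = τ * L.dualCost z s y := fun z => by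
    simp only [dualCost, mul_add, Finset.mul_sum, mul_assoc]
  refine le_antisymm ?_ ?_
  · obtain ⟨z, hz, hz'⟩ := L.exists_fluidValue_eq s y
    rw [hz', ← h]
    exact L.fluidValue_le_of_mem hz _ _
  · obtain ⟨z, hz, hz'⟩ := L.exists_fluidValue_eq (τ * s) fun k => τ * y k
    rw [hz', h]
    exact mul_le_mul_of_nonneg_left (L.fluidValue_le_of_mem hz _ _) hτ

lemma fluidValue_mono (s : ℝ) {y y' : Fin m → ℝ} (h : y ≤ y') :
    L.fluidValue s y ≤ L.fluidValue s y' := by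
  obtain ⟨z, hz, hz'⟩ := L.exists_fluidValue_eq s y'
  rw [hz']
  exact (L.fluidValue_le_of_mem hz _ _).trans (add_le_add le_rfl (Finset.sum_le_sum fun k _ =>
    mul_le_mul_of_nonneg_right (h k) (L.nonneg_of_mem_dualVertices hz k)))

/-- All supergradients of the limit value solve the first order equation. -/
lemma add_lossFunction_eq_zero_of_mem_superdifferential {T : ℕ} {x ζ : Fin (m + 1) → ℝ}
    (hx : x ∈ openDomain T m) (hζ : ζ ∈ superdifferential (openDomain T m) (L.limitValue T) x) :
    ζ 0 + L.lossFunction (fun k => ζ k.succ) = 0 := by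
  obtain ⟨hx0, hxT, hxk⟩ := hx
  have hs : 0 < T - x 0 := sub_pos.2 hxT
  -- `u` is positively homogeneous with respect to the vertex `(T, 0)`
  have heuler : L.limitValue T x = -ζ 0 * (T - x 0) + ∑ k : Fin m, ζ k.succ * x k.succ := by
    have hev : ∀ᶠ τ in 𝓝 (0 : ℝ), τ * (L.limitValue T x -
        (-ζ 0 * (T - x 0) + ∑ k : Fin m, ζ k.succ * x k.succ)) ≤ 0 := by
      have hcont : Continuous fun τ : ℝ =>
          (Fin.cons (T - (1 + τ) * (T - x 0)) fun k => (1 + τ) * x k.succ : Fin (m + 1) → ℝ) := by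
        refine continuous_pi fun i => ?_
        refine Fin.cases ?_ (fun k => ?_) i
        · simp only [Fin.cons_zero]
          fun_prop
        · simp only [Fin.cons_succ]
          fun_prop
      have hmem : ∀ᶠ τ in 𝓝 (0 : ℝ), (Fin.cons (T - (1 + τ) * (T - x 0))
          fun k => (1 + τ) * x k.succ : Fin (m + 1) → ℝ) ∈ openDomain T m := by
        refine hcont.continuousAt ((isOpen_openDomain T m).mem_nhds ⟨?_, ?_, fun k => ?_⟩)
        · simpa using hx0
        · simpa using hxT
        · simpa using hxk k
      filter_upwards [hmem, lt_mem_nhds (neg_one_lt_zero (R := ℝ))] with τ hτ hτ1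
      have h1 := hζ _ hτ
      simp only [limitValue, Fin.sum_univ_succ, Fin.cons_zero, Fin.cons_succ, sub_sub_cancel] at h1
      rw [L.fluidValue_mul (by linarith)] at h1
      have h2 : ∑ k : Fin m, ζ k.succ * ((1 + τ) * x k.succ - x k.succ) =
          τ * ∑ k : Fin m, ζ k.succ * x k.succ := by
        rw [Finset.mul_sum]
        exact Finset.sum_congr rfl fun k _ => by ring
      rw [h2] at h1
      rw [limitValue]
      linarith
    obtain ⟨δ, hδ, hball⟩ := Metric.eventually_nhds_iff.1 hev
    have h1 := hball (y := δ / 2) (by rw [dist_zero_right, Real.norm_of_nonneg] <;> linarith)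
    have h2 := hball (y := -(δ / 2))
      (by rw [dist_zero_right, norm_neg, Real.norm_of_nonneg] <;> linarith)
    nlinarith
  have hle : ∀ y ∈ openDomain T m,
      L.limitValue T y ≤ -ζ 0 * (T - y 0) + ∑ k : Fin m, ζ k.succ * y k.succ := fun y hy => by
    have h1 := hζ y hy
    rw [heuler, Fin.sum_univ_succ] at h1
    simp only [mul_sub, Finset.sum_sub_distrib] at h1 ⊢
    linarith
  have hpos : (0 : Fin m → ℝ) ≤ fun k => ζ k.succ := fun k => by
    have hsingle : (0 : Fin (m + 1) → ℝ) ≤ Pi.single k.succ 1 := Pi.single_nonneg.2 zero_le_one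
    have hmem : (x + Pi.single k.succ 1 : Fin (m + 1) → ℝ) ∈ openDomain T m := by
      refine ⟨by simpa using hx0, by simpa using hxT, fun j => ?_⟩
      rw [Pi.add_apply]
      exact add_pos_of_pos_of_nonneg (hxk j) (hsingle j.succ)
    have h1 := hζ _ hmem
    have h2 : L.limitValue T x ≤ L.limitValue T (x + Pi.single k.succ 1) := by
      have h3 : (x + Pi.single k.succ 1 : Fin (m + 1) → ℝ) 0 = x 0 := by simp
      rw [limitValue, limitValue, h3]
      refine L.fluidValue_mono _ fun j => ?_
      rw [Pi.add_apply]
      exact le_add_of_nonneg_right (hsingle j.succ)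
    simp only [Pi.add_apply, add_sub_cancel_left, Pi.single_apply, mul_ite, mul_one, mul_zero,
      Finset.sum_ite_eq', Finset.mem_univ, if_true] at h1
    simp only [Pi.zero_apply]
    linarith
  refine le_antisymm ?_ ?_
  · obtain ⟨r, hr0, hr1, hr⟩ := L.exists_rates_lossFunction_eq fun k => ζ k.succ
    have hT : (0 : ℝ) < T / 2 := by linarith
    have hε : ∀ ε : ℝ, 0 < ε →
        T / 2 * L.lossFunction (fun k => ζ k.succ) ≤
          -ζ 0 * (T / 2) + ε * ∑ k : Fin m, ζ k.succ := fun ε hε => by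
      have h1 := hle (Fin.cons (T / 2) fun k => T / 2 * ∑ i, r i * L.size i k + ε) (by
        refine ⟨by simpa using hT, by simpa using hT, fun k => ?_⟩
        rw [Fin.cons_succ]
        exact add_pos_of_nonneg_of_pos (mul_nonneg hT.le (Finset.sum_nonneg fun i _ =>
          mul_nonneg (hr0 i) (Nat.cast_nonneg _))) hε)
      simp only [limitValue, Fin.cons_zero, Fin.cons_succ, sub_half] at h1
      obtain ⟨z, hz, hz'⟩ := L.exists_fluidValue_eq ((T : ℝ) / 2)
        fun k => T / 2 * ∑ i, r i * L.size i k + ε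
      have h2 := L.sum_mul_price_le_dualCost hT.le hr0 hr1 (L.nonneg_of_mem_dualVertices hz)
        (y := fun k => T / 2 * ∑ i, r i * L.size i k + ε) fun k => le_add_of_nonneg_right hε.le
      rw [hz'] at h1
      have h3 : ∑ k : Fin m, ζ k.succ * (T / 2 * ∑ i, r i * L.size i k + ε) =
          T / 2 * ∑ i, r i * ∑ k, (L.size i k : ℝ) * ζ k.succ + ε * ∑ k : Fin m, ζ k.succ := by
        simp only [mul_add, Finset.sum_add_distrib, Finset.mul_sum]
        rw [Finset.sum_comm]
        congr 1
        · exact Finset.sum_congr rfl fun i _ => Finset.sum_congr rfl fun k _ => by ring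
        · exact Finset.sum_congr rfl fun k _ => by ring
      rw [hr]
      simp only [mul_sub, Finset.sum_sub_distrib] at h1 h2 h3 ⊢
      linarith
    have hlim : Tendsto (fun ε : ℝ => -ζ 0 * (T / 2) + ε * ∑ k : Fin m, ζ k.succ) (𝓝[>] 0)
        (𝓝 (-ζ 0 * (T / 2))) := by
      have : Continuous fun ε : ℝ => -ζ 0 * ((T : ℝ) / 2) + ε * ∑ k : Fin m, ζ k.succ := by
        fun_prop
      simpa using (this.tendsto 0).mono_left nhdsWithin_le_nhds
    have h4 := ge_of_tendsto hlim (eventually_mem_nhdsWithin.mono hε)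
    nlinarith
  · have h1 : L.limitValue T x ≤ L.dualCost (fun k => ζ k.succ) (T - x 0) fun k => x k.succ :=
      L.fluidValue_le_dualCost hs.le (fun k => (hxk k).le) hpos
    rw [heuler, dualCost] at h1
    simp only [mul_comm (x _)] at h1
    nlinarith

end RequestLaw

/-- The graph of a continuous function over the last coordinates is a null set. -/
lemma volume_setOf_add_eq_zero {m : ℕ} {g : (Fin m → ℝ) → ℝ} (hg : Continuous g) :
    volume {ζ : Fin (m + 1) → ℝ | ζ 0 + g (fun k => ζ k.succ) = 0} = 0 := by
  have hmp := volume_preserving_piFinSuccAbove (fun _ : Fin (m + 1) => ℝ) 0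
  have hmeas : MeasurableSet {p : ℝ × (Fin m → ℝ) | p.1 + g p.2 = 0} :=
    (isClosed_eq (by fun_prop) continuous_const).measurableSet
  have hpre : {ζ : Fin (m + 1) → ℝ | ζ 0 + g (fun k => ζ k.succ) = 0} =
      MeasurableEquiv.piFinSuccAbove (fun _ : Fin (m + 1) => ℝ) 0 ⁻¹'
        {p : ℝ × (Fin m → ℝ) | p.1 + g p.2 = 0} := rfl
  rw [hpre, hmp.measure_preimage hmeas.nullMeasurableSet, Measure.volume_eq_prod,
    Measure.prod_apply_symm hmeas]
  refine (lintegral_congr fun v => ?_).trans lintegral_zero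
  refine measure_mono_null (fun t ht => ?_) (measure_singleton (-g v))
  exact eq_neg_of_add_eq_zero_left ht

lemma volume_setOf_sum_mul_eq {N : ℕ} {a : Fin N → ℝ} (ha : a ≠ 0) (c : ℝ) :
    volume {x : Fin N → ℝ | ∑ i, a i * x i = c} = 0 := by
  obtain ⟨k, hk⟩ := Function.ne_iff.1 ha
  have hk : a k ≠ 0 := hk
  let S : AffineSubspace ℝ (Fin N → ℝ) :=
    { carrier := {x : Fin N → ℝ | ∑ i, a i * x i = c}
      smul_vsub_vadd_mem' := fun t x y z hx hy hz => by
        simp only [Set.mem_ofPred_eq] at hx hy hz ⊢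
        simp only [vsub_eq_sub, vadd_eq_add, Pi.add_apply, Pi.smul_apply, Pi.sub_apply, smul_eq_mul,
          mul_add, mul_sub, Finset.sum_add_distrib, Finset.sum_sub_distrib, mul_left_comm _ t,
          ← Finset.mul_sum, hx, hy, hz]
        ring }
  refine Measure.addHaar_affineSubspace volume S fun h => ?_
  have hmem : (Pi.single k ((c + 1) / a k) : Fin N → ℝ) ∈ S := h ▸ AffineSubspace.mem_top _ _ _
  have hmem : ∑ i, a i * (Pi.single k ((c + 1) / a k) : Fin N → ℝ) i = c := hmem
  simp only [Pi.single_apply, mul_ite, mul_zero, Finset.sum_ite_eq', Finset.mem_univ, if_true] at hmem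
  rw [mul_div_cancel₀ _ hk] at hmem
  linarith

namespace RequestLaw

variable {ι : Type*} [Fintype ι] {m : ℕ} (L : RequestLaw ι m)

lemma dualCost_eq_sum_dualGradient (T : ℕ) (z : Fin m → ℝ) (x : Fin (m + 1) → ℝ) :
    L.dualCost z (T - x 0) (fun k => x k.succ) =
      T * L.lossFunction z + ∑ i, L.dualGradient z i * x i := by
  simp only [dualCost, Fin.sum_univ_succ, dualGradient_zero, dualGradient_succ, mul_comm (z _)]
  ring

lemma ae_contDiffAt_limitValue (T : ℕ) : ∀ᵐ x, ContDiffAt ℝ 2 (L.limitValue T) x := by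
  have hne : ∀ᵐ x : Fin (m + 1) → ℝ, ∀ z ∈ L.dualVertices, ∀ w ∈ L.dualVertices, w ≠ z →
      L.dualCost z (T - x 0) (fun k => x k.succ) ≠ L.dualCost w (T - x 0) (fun k => x k.succ) := by
    refine (ae_ball_iff L.dualVertices.countable_toSet).2 fun z _ =>
      (ae_ball_iff L.dualVertices.countable_toSet).2 fun w _ => ?_
    by_cases hwz : w = z
    · exact Eventually.of_forall fun x h => absurd hwz h
    have ha : L.dualGradient z - L.dualGradient w ≠ 0 := fun h => by
      refine hwz (funext fun k => ?_)
      have := congrFun h k.succ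
      simp only [Pi.sub_apply, dualGradient_succ, Pi.zero_apply] at this
      linarith
    rw [ae_iff]
    refine measure_mono_null (fun x hx => ?_) (volume_setOf_sum_mul_eq ha
      (T * L.lossFunction w - T * L.lossFunction z))
    simp only [Set.mem_ofPred_eq, Classical.not_imp, not_not, dualCost_eq_sum_dualGradient] at hx
    simp only [Set.mem_ofPred_eq, Pi.sub_apply, sub_mul, Finset.sum_sub_distrib]
    linarith [hx.2]
  filter_upwards [hne] with x hx
  have hsmooth : ∀ z, ContDiff ℝ 2 fun y : Fin (m + 1) → ℝ =>
      L.dualCost z (T - y 0) (fun k => y k.succ) := fun z => by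
    simp only [dualCost_eq_sum_dualGradient]
    fun_prop
  obtain ⟨z, hz, hxz⟩ := L.exists_fluidValue_eq (T - x 0) fun k => x k.succ
  have hev : ∀ᶠ y in 𝓝 x, ∀ w ∈ L.dualVertices,
      L.dualCost z (T - y 0) (fun k => y k.succ) ≤ L.dualCost w (T - y 0) (fun k => y k.succ) := by
    refine (Finset.eventually_all _).2 fun w hw => ?_
    by_cases hwz : w = z
    · exact Eventually.of_forall fun y => by rw [hwz]
    have hlt := (hxz ▸ L.fluidValue_le_of_mem hw (T - x 0) fun k => x k.succ).lt_of_ne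
      (hx z hz w hw hwz)
    exact ((hsmooth z).continuous.continuousAt.eventually_lt (hsmooth w).continuous.continuousAt
      hlt).mono fun _ h => h.le
  refine (hsmooth z).contDiffAt.congr_of_eventuallyEq ?_
  filter_upwards [hev] with y hy
  refine le_antisymm (L.fluidValue_le_of_mem hz _ _) ?_
  obtain ⟨w, hw, hyw⟩ := L.exists_fluidValue_eq (T - y 0) fun k => y k.succ
  rw [limitValue, hyw]
  exact hy w hw

lemma hessianMatrix_limitValue_eq_zero {T : ℕ} {x : Fin (m + 1) → ℝ}
    (h : ContDiffAt ℝ 2 (L.limitValue T) x) : hessianMatrix (L.limitValue T) x = 0 := by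
  classical
  have hdiff : ∀ᶠ y in 𝓝 x, DifferentiableAt ℝ (L.limitValue T) y :=
    (h.eventually (by simp)).mono fun y hy => hy.differentiableAt (by simp)
  have hconst : ∀ j, partialDeriv j (L.limitValue T) =ᶠ[𝓝 x]
      fun _ => partialDeriv j (L.limitValue T) x := fun j => by
    set S : Finset ℝ := (L.dualVertices.image fun z => L.dualGradient z j).erase
      (partialDeriv j (L.limitValue T) x) with hS
    have hcont : ContinuousAt (partialDeriv j (L.limitValue T)) x := by
      have h1 : ContDiffAt ℝ 1 (fderiv ℝ (L.limitValue T)) x := h.fderiv_right (by norm_num)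
      exact h1.continuousAt.clm_apply continuousAt_const
    have hev := hcont.eventually (S.finite_toSet.isClosed.isOpen_compl.mem_nhds
      (by simp [hS]))
    filter_upwards [hev, hdiff] with y hy hdy
    by_contra hne
    obtain ⟨z, hz, hgrad⟩ := L.exists_grad_limitValue_eq hdy
    refine hy (Finset.mem_coe.2 (Finset.mem_erase.2 ⟨hne, Finset.mem_image.2 ⟨z, hz, ?_⟩⟩))
    exact (congrFun hgrad j).symm
  ext i j
  change fderiv ℝ (partialDeriv j (L.limitValue T)) x (Pi.single i 1) = 0
  simp [(hconst j).fderiv_eq]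

lemma partialDeriv_add_lossFunction_eq_zero {T : ℕ} {x : Fin (m + 1) → ℝ}
    (h : DifferentiableAt ℝ (L.limitValue T) x) :
    partialDeriv 0 (L.limitValue T) x +
      L.lossFunction (fun k : Fin m => partialDeriv k.succ (L.limitValue T) x) = 0 := by
  obtain ⟨z, -, hz⟩ := L.exists_grad_limitValue_eq h
  have h1 : partialDeriv 0 (L.limitValue T) x = _ := congrFun hz 0
  have h2 : (fun k : Fin m => partialDeriv k.succ (L.limitValue T) x) = z :=
    funext fun k => congrFun hz k.succ
  rw [h1, h2, dualGradient_zero, neg_add_cancel]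

lemma lossFunction_eq_of_unit_size (hsize : ∀ i, 0 < L.price i → ∀ k, L.size i k = 1)
    {z : Fin m → ℝ} (hz : 0 ≤ z) :
    L.lossFunction z = ∑ i, L.prob i * max (L.price i - ∑ k : Fin m, z k) 0 := by
  refine Finset.sum_congr rfl fun i _ => ?_
  by_cases hi : 0 < L.price i
  · simp [hsize i hi]
  · have hp : L.price i = 0 := le_antisymm (not_lt.1 hi) (L.price_nonneg i)
    have h1 : 0 ≤ ∑ k, (L.size i k : ℝ) * z k :=
      Finset.sum_nonneg fun k _ => mul_nonneg (Nat.cast_nonneg _) (hz k)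
    have h2 : 0 ≤ ∑ k, z k := Finset.sum_nonneg fun k _ => hz k
    rw [hp, max_eq_right (by linarith), max_eq_right (by linarith)]

lemma isViscositySolution_limitValue (T : ℕ) :
    IsViscositySolution (fun ζ => ζ 0 + L.lossFunction (fun k => ζ k.succ)) (openDomain T m)
      (L.limitValue T) := by
  obtain ⟨K, hK⟩ := L.exists_lipschitzWith_limitValue T
  refine ⟨hK.continuous.continuousOn, fun x hx φ hφ => ⟨fun hmax => ?_, fun hmin => ?_⟩⟩
  · exact (L.add_lossFunction_eq_zero_of_mem_superdifferential hx (grad_mem_superdifferential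
      (L.concaveOn_limitValue T) hx (hφ.differentiable one_ne_zero x) hmax)).ge
  · obtain ⟨z, -, hz⟩ := L.exists_grad_eq_dualGradient (T := T)
      (hφ.differentiable one_ne_zero x) (hmin.mono fun y hy => by linarith)
    simp [hz]

lemma isAlexandrovHomogeneousMA_limitValue (T : ℕ) :
    IsAlexandrovHomogeneousMA (openDomain T m) (L.limitValue T) := by
  refine ⟨L.concaveOn_limitValue T, measure_mono_null ?_
    (volume_setOf_add_eq_zero L.continuous_lossFunction)⟩
  exact Set.iUnion₂_subset fun x hx ζ hζ =>
    L.add_lossFunction_eq_zero_of_mem_superdifferential hx hζ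

lemma tendsto_value_div {T : ℕ} {x : Fin (m + 1) → ℝ} (hx : x ∈ closedDomain T m) :
    Tendsto (fun n : ℕ => L.value (n * T) ⌊(n : ℝ) * x 0⌋₊ (scaledInventory n x) / n) atTop
      (𝓝 (L.limitValue T x)) :=
  L.tendsto_valueToGo_div (sub_nonneg.2 hx.2.1) hx.2.2 (tendsto_periodsToGo_div hx.1 hx.2.1)
    fun j => tendsto_scaledInventory_div j (hx.2.2 j)

lemma tendsto_value_last_period_div (T : ℕ) (x : Fin (m + 1) → ℝ) :
    Tendsto (fun n : ℕ => L.value (n * T) (n * T) (scaledInventory n x) / n) atTop (𝓝 0) := by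
  refine squeeze_zero (fun n => div_nonneg (L.valueToGo_nonneg _ _) (Nat.cast_nonneg n))
    (fun n => ?_) (tendsto_const_div_atTop_nhds_zero_nat (∑ i, L.price i))
  refine div_le_div_of_nonneg_right ?_ (Nat.cast_nonneg n)
  rw [value, Nat.add_sub_cancel_left]
  simpa [valueToGo] using L.valueToGo_succ_le 0 (scaledInventory n x)

lemma limitValue_terminal {T : ℕ} {x : Fin (m + 1) → ℝ} (hx : x ∈ closedDomain T m)
    (hxT : x 0 = T) : L.limitValue T x = 0 := by
  refine tendsto_nhds_unique (L.tendsto_value_div hx)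
    ((L.tendsto_value_last_period_div T x).congr fun n => ?_)
  rw [hxT, ← Nat.cast_mul, Nat.floor_natCast]

lemma limitValue_zero_inventory {T : ℕ} {x : Fin (m + 1) → ℝ} (hx : x ∈ closedDomain T m)
    (hx0 : ∀ k : Fin m, x k.succ = 0) : L.limitValue T x = 0 := by
  refine tendsto_nhds_unique (L.tendsto_value_div hx) (tendsto_const_nhds.congr fun n => ?_)
  have h : scaledInventory n x = 0 := funext fun k => by simp [scaledInventory, hx0]
  rw [h, value, valueToGo_zero_inventory, zero_div]

end RequestLaw

end

theorem mainTheorem2 {ι : Type*} [Fintype ι] [MeasurableSpace ι] [DiscreteMeasurableSpace ι]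
    {m : ℕ} (L : RequestLaw ι m) (T : ℕ)
    {Ω : Type*} [MeasurableSpace Ω] (μ : Measure Ω) [IsProbabilityMeasure μ]
    (ξ : ℕ → Ω → ι) (hmeas : ∀ s, Measurable (ξ s)) (hindep : iIndepFun ξ μ)
    (hlaw : ∀ s i, μ.real (ξ s ⁻¹' {i}) = L.prob i) :
    ∃ (u : (Fin (m + 1) → ℝ) → ℝ) (h : (Fin m → ℝ) → ℝ),
      -- convergence of the scaled value function and of the scaled optimal reward
      (∀ x ∈ closedDomain T m,
        Tendsto (fun n : ℕ =>
          L.value (n * T) ⌊(n : ℝ) * x 0⌋₊ (scaledInventory n x) / n) atTop (𝓝 (u x))) ∧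
      (∀ x ∈ closedDomain T m, ∀ᵐ ω ∂μ,
        Tendsto (fun n : ℕ =>
          L.revenue (fun s => ξ s ω) (n * T) ⌊(n : ℝ) * x 0⌋₊ (scaledInventory n x) / n)
          atTop (𝓝 (u x))) ∧
      -- regularity
      (∃ K, LipschitzOnWith K u (closedDomain T m)) ∧
      (∀ᵐ x ∂volume.restrict (openDomain T m), ContDiffAt ℝ 2 u x) ∧
      -- the first order equation
      IsViscositySolution (fun ζ => ζ 0 + L.lossFunction (fun k => ζ k.succ))
        (openDomain T m) u ∧
      (∀ x ∈ openDomain T m, DifferentiableAt ℝ u x →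
        partialDeriv 0 u x + L.lossFunction (fun k : Fin m => partialDeriv k.succ u x) = 0) ∧
      ((∀ i, 0 < L.price i → ∀ k, L.size i k = 1) →
        ∀ x ∈ openDomain T m, DifferentiableAt ℝ u x →
          partialDeriv 0 u x +
            ∑ i, L.prob i * max (L.price i - ∑ k : Fin m, partialDeriv k.succ u x) 0 = 0) ∧
      -- terminal and boundary conditions
      (∀ x ∈ closedDomain T m, x 0 = T →
        Tendsto (fun n : ℕ => L.value (n * T) (n * T) (scaledInventory n x) / n) atTop
            (𝓝 (h fun k => x k.succ)) ∧
          u x = h (fun k => x k.succ) ∧ h (fun k => x k.succ) = 0) ∧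
      (∀ x ∈ closedDomain T m, (∀ k : Fin m, x k.succ = 0) → u x = 0) ∧
      -- the homogeneous Monge–Ampère equation
      (∀ x ∈ openDomain T m, ContDiffAt ℝ 2 u x → (hessianMatrix u x).det = 0) ∧
      IsAlexandrovHomogeneousMA (openDomain T m) u := by
  obtain ⟨K, hK⟩ := L.exists_lipschitzWith_limitValue T
  refine ⟨L.limitValue T, fun _ => 0, fun x hx => L.tendsto_value_div hx, fun x hx => ?_,
    ⟨K, hK.lipschitzOnWith⟩, ae_restrict_of_ae (L.ae_contDiffAt_limitValue T),
    L.isViscositySolution_limitValue T, fun x _ h => L.partialDeriv_add_lossFunction_eq_zero h,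
    fun hsize x _ h => ?_,
    fun x hx hxT => ⟨L.tendsto_value_last_period_div T x, L.limitValue_terminal hx hxT, rfl⟩,
    fun x hx hx0 => L.limitValue_zero_inventory hx hx0, fun x _ h => ?_,
    L.isAlexandrovHomogeneousMA_limitValue T⟩
  · exact L.ae_tendsto_revenueToGo_div hmeas hindep hlaw (fun n => Nat.sub_le _ _)
      (fun n => ⌊(n : ℝ) * x 0⌋₊) (fun n => scaledInventory n x) (L.tendsto_value_div hx)
  · obtain ⟨z, hzZ, hz⟩ := L.exists_grad_limitValue_eq h
    have hz' : (fun k : Fin m => partialDeriv k.succ (L.limitValue T) x) = z :=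
      funext fun k => congrFun hz k.succ
    have hfirst := L.partialDeriv_add_lossFunction_eq_zero h
    rwa [L.lossFunction_eq_of_unit_size hsize
      (hz' ▸ L.nonneg_of_mem_dualVertices hzZ)] at hfirst
  · rw [L.hessianMatrix_limitValue_eq_zero h, Matrix.det_zero]
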